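/- For a discrete group $G$, let $C^*(G)$ be its full (maximal) $C^*$-algebra and $U_G : G \to C^*(G)$ its universal unitary representation. A subset $\Lambda \subset G$ is called completely Sidon if the unitaries $(U_G(t))_{t\in\Lambda}$ span in $C^*(G)$ a copy of $\ell_1(\Lambda)$ equipped with its maximal operator space structure, that is: if there is a constant $C$ such that for every $m \ge 1$ and every finitely supported family $(a_t)_{t\in\Lambda}$ in $M_m(\mathbb C)$, $$\Big\|\sum_{t\in\Lambda} a_t\otimes U_t\Big\|_{M_m(C^*(\mathbb F_\Lambda))} \le C\,\Big\|\sum_{t\in\Lambda} a_t\otimes U_G(t)\Big\|_{M_m(C^*(G))},$$ where $\mathbb F_\Lambda$ is the free group with free generators $(g_t)_{t\in\Lambda}$ and $U_t = U_{\mathbb F_\Lambda}(g_t)$. Let $G$ be any discrete group. If $\Lambda_1,\Lambda_2\subset G$ are completely Sidon, then $\Lambda_1\cup\Lambda_2$ is completely Sidon. -/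

import Mathlib

open scoped ENNReal

universe u

/-- A unitary representation of the (discrete) group `G` on a nonzero complex Hilbert space. -/
structure UnitaryRep (G : Type u) [Group G] : Type (u + 1) where
  /-- The Hilbert space. Every cyclic representation of `G` is unitarily equivalent to one on a
  completion of a quotient of `ℂ[G]`, so spaces in the universe of `G` suffice. -/
  H : Type u
  [normedAddCommGroup : NormedAddCommGroup H]
  [innerProductSpace : InnerProductSpace ℂ H]
  [completeSpace : CompleteSpace H]
  [nontrivial : Nontrivial H]
  /-- The homomorphism into the unitary group of `B(H)`. -/
  hom : G →* unitary (H →L[ℂ] H)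

namespace UnitaryRep

attribute [instance] normedAddCommGroup innerProductSpace completeSpace nontrivial

variable {G : Type u} [Group G]

/-- The `ℓ^∞`-direct sum of the algebras `B(H_π)` over all unitary representations `π` of `G`. -/
abbrev BoundedProduct (G : Type u) [Group G] : Type (u + 1) :=
  lp (fun π : UnitaryRep G => π.H →L[ℂ] π.H) ∞

noncomputable instance : NormedAlgebra ℂ (BoundedProduct G) where
  norm_smul_le := norm_smul_le

noncomputable instance : CStarAlgebra (BoundedProduct G) where

/-- The element `(π(t))_π`, the direct sum of all unitary representations evaluated at `t`. -/
noncomputable def universalElement (t : G) : BoundedProduct G :=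
  ⟨fun π => (π.hom t : π.H →L[ℂ] π.H), memℓp_infty ⟨1, by
    rintro _ ⟨π, rfl⟩
    exact (CStarRing.norm_coe_unitary (π.hom t)).le⟩⟩

end UnitaryRep

/-- The closed unital *-subalgebra generated by the direct sum of all unitary representations
of `G`. -/
noncomputable def groupCStarSubalgebra (G : Type u) [Group G] :
    StarSubalgebra ℂ (UnitaryRep.BoundedProduct G) :=
  (StarAlgebra.adjoin ℂ (Set.range (UnitaryRep.universalElement (G := G)))).topologicalClosure

instance (G : Type u) [Group G] :
    IsClosed (groupCStarSubalgebra G : Set (UnitaryRep.BoundedProduct G)) :=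
  StarSubalgebra.isClosed_topologicalClosure _

/-- The full (maximal) C*-algebra `C*(G)` of the discrete group `G`. -/
def GroupCStar (G : Type u) [Group G] : Type (u + 1) :=
  groupCStarSubalgebra G

namespace GroupCStar

variable {G : Type u} [Group G]

noncomputable instance : CStarAlgebra (GroupCStar G) :=
  inferInstanceAs (CStarAlgebra (groupCStarSubalgebra G))

/-- The usual order of the C*-algebra `C*(G)`. -/
noncomputable instance : PartialOrder (GroupCStar G) :=
  CStarAlgebra.spectralOrder (GroupCStar G)

instance : StarOrderedRing (GroupCStar G) :=
  CStarAlgebra.spectralOrderedRing (GroupCStar G)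

/-- The element `U_G(t)` of `C*(G)`. -/
noncomputable def universalUnitary (t : G) : GroupCStar G :=
  (⟨UnitaryRep.universalElement t, StarSubalgebra.le_topologicalClosure _
    (StarAlgebra.subset_adjoin ℂ _ (Set.mem_range_self t))⟩ : groupCStarSubalgebra G)

theorem universalUnitary_mem (t : G) : universalUnitary t ∈ unitary (GroupCStar G) := by
  rw [Unitary.mem_iff]
  constructor <;> apply Subtype.ext <;> apply lp.ext <;> funext π
  · exact Unitary.coe_star_mul_self (π.hom t)
  · exact Unitary.coe_mul_star_self (π.hom t)

/-- The universal unitary representation `U_G` of `G` in `C*(G)`. -/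
noncomputable def universalRep : G →* unitary (GroupCStar G) where
  toFun t := ⟨universalUnitary t, universalUnitary_mem t⟩
  map_one' := by
    apply Subtype.ext; apply Subtype.ext; apply lp.ext; funext π
    exact congrArg Subtype.val (map_one π.hom)
  map_mul' s t := by
    apply Subtype.ext; apply Subtype.ext; apply lp.ext; funext π
    exact congrArg Subtype.val (map_mul π.hom s t)

end GroupCStar

/-- The element `∑_{i ∈ s} a_i ⊗ x_i` of `M_m ⊗ A = M_m(A)`. The norm of `CStarMatrix` is the
C*-norm of `M_m(A)`, that is, the minimal tensor norm. -/
def matrixCoeffSum {ι A : Type*} [AddCommMonoid A] [SMul ℂ A] {m : ℕ}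
    (s : Finset ι) (a : ι → Matrix (Fin m) (Fin m) ℂ) (x : ι → A) :
    CStarMatrix (Fin m) (Fin m) A :=
  CStarMatrix.ofMatrix (Matrix.of fun p q => ∑ i ∈ s, a i p q • x i)

/-- A bounded family `(ψ_i)` in a C*-algebra `A` is completely Sidon if, for some constant `C`,
`‖∑ a_i ⊗ U_i‖ ≤ C ‖∑ a_i ⊗ ψ_i‖` for all finite sums with matrix coefficients `a_i` of any size,
where the `U_i` are the canonical unitary generators of the full C*-algebra of the free group on
the index set. The span of the `U_i` is `ℓ₁` with its maximal operator space structure. -/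
def IsCompletelySidon {ι : Type u} {A : Type*} [NonUnitalCStarAlgebra A] [PartialOrder A]
    [StarOrderedRing A] (ψ : ι → A) : Prop :=
  (∃ R : ℝ, ∀ i, ‖ψ i‖ ≤ R) ∧
  ∃ C : ℝ, ∀ (m : ℕ) (s : Finset ι) (a : ι → Matrix (Fin m) (Fin m) ℂ),
    ‖matrixCoeffSum s a
        (fun i => (GroupCStar.universalRep (FreeGroup.of i) : GroupCStar (FreeGroup ι)))‖ ≤
      C * ‖matrixCoeffSum s a ψ‖

/-- A subset `Λ` of a discrete group `G` is completely Sidon if the family `(U_G(t))_{t ∈ Λ}` is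
completely Sidon in `C*(G)`. -/
def IsCompletelySidonSet {G : Type u} [Group G] (Λ : Set G) : Prop :=
  IsCompletelySidon (fun t : Λ => (GroupCStar.universalRep (t : G) : GroupCStar G))

/-!
The heart of the matter is an interpolation property: if `Λ` is completely Sidon, then for every
`ε > 0` there is a completely bounded multiplier of `C*(G)`, given by a function on `G` that equals
`1` on `Λ` and is at most `ε` in absolute value off `Λ`.

To construct it, let `F` be the free group on `Λ`. The Sidon inequality, tensored with finite
quotients of the residually finite group `F`, says that the functional on `M₂(C*(G × F))` which is
`C` times the trace of `F` on the diagonal and sends the corner `U_G(t) ⊗ U_w` to `1` if `w` is the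
free generator of `t` and to `0` otherwise is positive on the operator system where it is defined.
It extends to a positive definite matrix-valued function `s` on `G × F`. By positivity of the trace
on the algebra of translation invariant operators on `ℓ²(F)`, the fibre sums
`h(γ) = ∑ θ(w) |s(γ, w)|²` over the `w` that are mapped to `γ` by the homomorphism `F → G` induced
by `Λ ⊆ G` are positive definite whenever `θ` is positive definite on `F`. Haagerup's function
`r ^ |w|`, cut down by a positive definite `2 × 2` matrix-valued function whose corner is the
indicator of the words of degree `1` modulo `3`, provides a `θ` whose corner is `r` at the
generators and at most `r²` at all other words. Hence the corner of `h` is `r` on `Λ` and, by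
Bessel's inequality, at most `C² r²` off `Λ`; divided by `r`, it is the required multiplier when
`r` is small.

For a union, multiply the coefficients on `Λ₁ ∪ Λ₂` by the multiplier of `Λ₁`: this cuts out the
part on `Λ₁`, and what remains lives on `Λ₂`, up to an error of at most a small multiple of the norm
over the free group, which is the norm to be estimated and absorbs it.
-/

open scoped ComplexOrder Matrix

/-! ### Matrix coefficients and the norm of `M_m(C*(G))` -/

section MeanNormSq

variable {n H : Type*} [Fintype n] [NormedAddCommGroup H]

/-- The mean of the squared `ℓ²`-norms of two tuples of vectors. It serves as the right-hand side
of bounds on sesquilinear forms: unlike the product of the two norms it is additive over the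
entries, and optimizing over rescalings of the two tuples shows that it gives the same bounds. -/
noncomputable def meanNormSq (ξ η : n → H) : ℝ :=
  ((∑ p, ‖ξ p‖ ^ 2) + ∑ q, ‖η q‖ ^ 2) / 2

theorem meanNormSq_nonneg (ξ η : n → H) : 0 ≤ meanNormSq ξ η := by
  unfold meanNormSq; positivity

theorem meanNormSq_eq (ξ η : PiLp 2 (fun _ : n => H)) :
    meanNormSq (fun p => ξ p) (fun q => η q) = (‖ξ‖ ^ 2 + ‖η‖ ^ 2) / 2 := by
  rw [meanNormSq, PiLp.norm_sq_eq_of_L2, PiLp.norm_sq_eq_of_L2]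

end MeanNormSq

section OperatorMatrix

variable {n H : Type*} [Fintype n] [NormedAddCommGroup H] [InnerProductSpace ℂ H]

/-- The operator on `H^n` with the given matrix of operators on `H`. -/
noncomputable def opOfMatrix (M : n → n → H →L[ℂ] H) :
    PiLp 2 (fun _ : n => H) →L[ℂ] PiLp 2 (fun _ : n => H) :=
  (PiLp.continuousLinearEquiv 2 ℂ (fun _ : n => H)).symm.toContinuousLinearMap ∘L
    ContinuousLinearMap.pi fun p => ∑ q, M p q ∘L PiLp.proj 2 (fun _ : n => H) q

theorem opOfMatrix_apply (M : n → n → H →L[ℂ] H) (ξ : PiLp 2 (fun _ : n => H)) (p : n) :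
    opOfMatrix M ξ p = ∑ q, M p q (ξ q) := by
  simp [opOfMatrix]

theorem inner_opOfMatrix (M : n → n → H →L[ℂ] H) (ξ η : PiLp 2 (fun _ : n => H)) :
    inner ℂ ξ (opOfMatrix M η) = ∑ p, ∑ q, inner ℂ (ξ p) (M p q (η q)) := by
  simp [PiLp.inner_apply, opOfMatrix_apply, inner_sum]

theorem norm_opOfMatrix_le_iff (M : n → n → H →L[ℂ] H) {R : ℝ} (hR : 0 ≤ R) :
    ‖opOfMatrix M‖ ≤ R ↔ ∀ ξ η : n → H,
      ‖∑ p, ∑ q, inner ℂ (ξ p) (M p q (η q))‖ ≤ R * meanNormSq ξ η := by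
  constructor
  · intro h ξ η
    have hinner := inner_opOfMatrix M (WithLp.toLp 2 ξ) (WithLp.toLp 2 η)
    have hmean := meanNormSq_eq (WithLp.toLp 2 ξ) (WithLp.toLp 2 η)
    rw [← hinner, hmean]
    calc ‖inner ℂ (WithLp.toLp 2 ξ) (opOfMatrix M (WithLp.toLp 2 η))‖
        ≤ ‖WithLp.toLp 2 ξ‖ * ‖opOfMatrix M (WithLp.toLp 2 η)‖ := norm_inner_le_norm _ _
      _ ≤ ‖WithLp.toLp 2 ξ‖ * (R * ‖WithLp.toLp 2 η‖) := by
        gcongr; exact (opOfMatrix M).le_of_opNorm_le h _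
      _ = R * (‖WithLp.toLp 2 ξ‖ * ‖WithLp.toLp 2 η‖) := by ring
      _ ≤ R * ((‖WithLp.toLp 2 ξ‖ ^ 2 + ‖WithLp.toLp 2 η‖ ^ 2) / 2) := by
        gcongr
        linarith [two_mul_le_add_sq ‖WithLp.toLp 2 ξ‖ ‖WithLp.toLp 2 η‖]
  · intro h
    refine ContinuousLinearMap.opNorm_le_of_re_inner_le hR fun η ξ hη hξ => ?_
    have hform := h (fun p => ξ p) (fun q => η q)
    rw [meanNormSq_eq, hη, hξ, ← inner_opOfMatrix] at hform
    refine (RCLike.re_le_norm _).trans ?_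
    rw [norm_inner_symm]
    linarith

theorem eq_zero_of_opOfMatrix_eq_zero {M : n → n → H →L[ℂ] H} (h : opOfMatrix M = 0) (p q : n) :
    M p q = 0 := by
  classical
  ext x
  have := congrArg (fun T => T (PiLp.single 2 q x) p) h
  simpa [opOfMatrix_apply, Pi.single_apply, apply_ite] using this

variable [CompleteSpace H]

/-- `opOfMatrix` as a star homomorphism. -/
noncomputable def opOfMatrixHom :
    CStarMatrix n n (H →L[ℂ] H) →⋆ₙₐ[ℂ]
      (PiLp 2 (fun _ : n => H) →L[ℂ] PiLp 2 (fun _ : n => H)) where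
  toFun M := opOfMatrix fun p q => M p q
  map_smul' c M := by
    ext ξ p
    simp [opOfMatrix_apply, Finset.smul_sum]
  map_zero' := by
    ext ξ p
    simp [opOfMatrix_apply]
  map_add' M N := by
    ext ξ p
    simp [opOfMatrix_apply, Finset.sum_add_distrib]
  map_mul' M N := by
    ext ξ p
    rw [mul_apply_eq_comp]
    simp only [opOfMatrix_apply, CStarMatrix.mul_apply, sum_apply, map_sum,
      mul_apply_eq_comp]
    rw [Finset.sum_comm]
  map_star' M := by
    rw [ContinuousLinearMap.star_eq_adjoint, ContinuousLinearMap.eq_adjoint_iff]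
    intro ξ η
    rw [inner_opOfMatrix, ← inner_conj_symm, inner_opOfMatrix, map_sum, Finset.sum_comm]
    refine Finset.sum_congr rfl fun p _ => ?_
    rw [map_sum]
    refine Finset.sum_congr rfl fun q _ => ?_
    rw [inner_conj_symm, CStarMatrix.star_apply, ContinuousLinearMap.star_eq_adjoint,
      ContinuousLinearMap.adjoint_inner_left]

end OperatorMatrix

theorem norm_le_iff_of_jointly_injective {κ A : Type*} {B : κ → Type*}
    [NonUnitalCStarAlgebra A] [∀ i, NonUnitalCStarAlgebra (B i)] (φ : ∀ i, A →⋆ₙₐ[ℂ] B i)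
    (hφ : ∀ a, (∀ i, φ i a = 0) → a = 0) (a : A) {R : ℝ} (hR : 0 ≤ R) :
    ‖a‖ ≤ R ↔ ∀ i, ‖φ i a‖ ≤ R := by
  refine ⟨fun h i => (NonUnitalStarAlgHom.norm_apply_le (φ i) a).trans h, fun h => ?_⟩
  let Φ : A →⋆ₙₐ[ℂ] lp B ∞ :=
    { toFun := fun a => ⟨fun i => φ i a, memℓp_infty ⟨‖a‖, by
        rintro _ ⟨i, rfl⟩
        exact NonUnitalStarAlgHom.norm_apply_le (φ i) a⟩⟩
      map_smul' := fun c x => by ext1; funext i; exact map_smul (φ i) c x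
      map_zero' := by ext1; funext i; exact map_zero (φ i)
      map_add' := fun x y => by ext1; funext i; exact map_add (φ i) x y
      map_mul' := fun x y => by ext1; funext i; exact map_mul (φ i) x y
      map_star' := fun x => by ext1; funext i; exact map_star (φ i) x }
  have hΦ : Function.Injective Φ := by
    rw [injective_iff_map_eq_zero]
    exact fun x hx => hφ x fun i => congrArg (fun f : lp B ∞ => f i) hx
  rw [← NonUnitalStarAlgHom.norm_map Φ hΦ a]
  exact lp.norm_le_of_forall_le hR h

namespace GroupCStar

variable {G : Type u} [Group G]

/-- The star homomorphism `C*(G) → B(H_π)` induced by a unitary representation. -/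
noncomputable def evalRep (π : UnitaryRep G) : GroupCStar G →⋆ₙₐ[ℂ] (π.H →L[ℂ] π.H) where
  toFun x := (Subtype.val (p := fun y => y ∈ groupCStarSubalgebra G) x) π
  map_smul' _ _ := rfl
  map_zero' := rfl
  map_add' _ _ := rfl
  map_mul' _ _ := rfl
  map_star' _ := rfl

theorem evalRep_universalRep (π : UnitaryRep G) (t : G) :
    evalRep π (universalRep t : GroupCStar G) = π.hom t := rfl

theorem eq_zero_of_evalRep_eq_zero {x : GroupCStar G} (h : ∀ π, evalRep π x = 0) : x = 0 := by
  apply Subtype.ext; apply lp.ext; funext π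
  exact h π

/-- The star homomorphism `M_m(C*(G)) → B(H_π^m)` induced by a unitary representation. -/
noncomputable def evalMatrix (m : ℕ) (π : UnitaryRep G) :
    CStarMatrix (Fin m) (Fin m) (GroupCStar G) →⋆ₙₐ[ℂ]
      (PiLp 2 (fun _ : Fin m => π.H) →L[ℂ] PiLp 2 (fun _ : Fin m => π.H)) :=
  opOfMatrixHom.comp (CStarMatrix.mapₙₐ (evalRep π))

theorem evalMatrix_apply {m : ℕ} (π : UnitaryRep G)
    (M : CStarMatrix (Fin m) (Fin m) (GroupCStar G)) :
    evalMatrix m π M = opOfMatrix fun p q => evalRep π (M p q) := rfl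

theorem norm_le_iff_forall_evalMatrix {m : ℕ} (M : CStarMatrix (Fin m) (Fin m) (GroupCStar G))
    {R : ℝ} (hR : 0 ≤ R) : ‖M‖ ≤ R ↔ ∀ π : UnitaryRep G, ‖evalMatrix m π M‖ ≤ R := by
  refine norm_le_iff_of_jointly_injective (fun π => evalMatrix m π) (fun M hM => ?_) M hR
  ext p q
  refine eq_zero_of_evalRep_eq_zero fun π => ?_
  have h := hM π
  rw [evalMatrix_apply] at h
  exact eq_zero_of_opOfMatrix_eq_zero h p q

end GroupCStar

namespace UnitaryRep

variable {G : Type u} [Group G]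

/-- The unitary operator `π(g)`, as a bounded operator. -/
noncomputable abbrev op (π : UnitaryRep G) (g : G) : π.H →L[ℂ] π.H := π.hom g

/-- The sesquilinear form of `∑_{i ∈ s} a_i ⊗ π(g_i)` at the pair of tuples `ξ, η` in `H_π^n`. -/
noncomputable def coeffForm {ι n : Type*} [Fintype n] (π : UnitaryRep G) (s : Finset ι)
    (a : ι → Matrix n n ℂ) (g : ι → G) (ξ η : n → π.H) : ℂ :=
  ∑ p, ∑ q, ∑ i ∈ s, a i p q * inner ℂ (ξ p) (π.op (g i) (η q))

end UnitaryRep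

section UniversalNorm

variable {G : Type u} [Group G] {ι : Type*} {m : ℕ}

/-- The norm of `∑_{i ∈ s} a_i ⊗ U_G(g_i)` in `M_m(C*(G))`. -/
noncomputable def universalNorm (s : Finset ι) (a : ι → Matrix (Fin m) (Fin m) ℂ) (g : ι → G) :
    ℝ :=
  ‖matrixCoeffSum s a fun i => (GroupCStar.universalRep (g i) : GroupCStar G)‖

theorem universalNorm_nonneg (s : Finset ι) (a : ι → Matrix (Fin m) (Fin m) ℂ) (g : ι → G) :
    0 ≤ universalNorm s a g :=
  norm_nonneg _

theorem universalNorm_le_iff (s : Finset ι) (a : ι → Matrix (Fin m) (Fin m) ℂ) (g : ι → G)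
    {R : ℝ} (hR : 0 ≤ R) :
    universalNorm s a g ≤ R ↔
      ∀ (π : UnitaryRep G) (ξ η : Fin m → π.H),
        ‖π.coeffForm s a g ξ η‖ ≤ R * meanNormSq ξ η := by
  rw [universalNorm, GroupCStar.norm_le_iff_forall_evalMatrix _ hR]
  refine forall_congr' fun π => ?_
  rw [GroupCStar.evalMatrix_apply, norm_opOfMatrix_le_iff _ hR]
  simp only [UnitaryRep.coeffForm, matrixCoeffSum, CStarMatrix.ofMatrix_apply, Matrix.of_apply,
    map_sum, map_smul, GroupCStar.evalRep_universalRep, sum_apply, inner_sum, smul_apply,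
    inner_smul_right]

theorem norm_coeffForm_le_universalNorm (s : Finset ι) (a : ι → Matrix (Fin m) (Fin m) ℂ)
    (g : ι → G) (π : UnitaryRep G) (ξ η : Fin m → π.H) :
    ‖π.coeffForm s a g ξ η‖ ≤ universalNorm s a g * meanNormSq ξ η :=
  (universalNorm_le_iff s a g (universalNorm_nonneg s a g)).mp le_rfl π ξ η

end UniversalNorm

/-! ### Positive definite functions -/

section Gram

variable {X H : Type*} [NormedAddCommGroup H] [InnerProductSpace ℂ H]

theorem inner_linearCombination_eq_sum (v : X → H) (c d : X →₀ ℂ) :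
    inner ℂ (Finsupp.linearCombination ℂ v c) (Finsupp.linearCombination ℂ v d) =
      c.sum fun x cx => d.sum fun y dy => star cx * inner ℂ (v x) (v y) * dy := by
  simp only [Finsupp.linearCombination_apply, Finsupp.sum, sum_inner, inner_sum,
    inner_smul_left, inner_smul_right, starRingEnd_apply]
  rw [Finset.sum_comm]
  simp only [Finset.mul_sum]
  exact Finset.sum_congr rfl fun x _ => Finset.sum_congr rfl fun y _ => by ring

theorem posSemidef_of_inner_eq {M : Matrix X X ℂ} (v : X → H)
    (h : ∀ x y, M x y = inner ℂ (v x) (v y)) : M.PosSemidef := by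
  refine ⟨?_, fun c => ?_⟩
  · ext x y
    rw [Matrix.conjTranspose_apply, h, h, RCLike.star_def, inner_conj_symm]
  · simp only [h]
    rw [← inner_linearCombination_eq_sum, inner_self_eq_norm_sq_to_K]
    simp

end Gram

theorem exists_gram_of_posSemidef {X : Type u} {M : Matrix X X ℂ} (hM : M.PosSemidef) :
    ∃ (H : Type u) (_ : NormedAddCommGroup H) (_ : InnerProductSpace ℂ H) (_ : CompleteSpace H)
      (v : X → H), (∀ x y, inner ℂ (v x) (v y) = M x y) ∧
        Dense (Submodule.span ℂ (Set.range v) : Set H) := by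
  let K : Matrix X X (ℂ →L[ℂ] ℂ) := Matrix.of fun x y => M x y • 1
  have hconj (x y : X) : starRingEnd ℂ (M y x) = M x y := hM.isHermitian.apply x y
  have hK : K.PosSemidef := by
    refine ((RKHS.posSemidef_tfae (K := K)).out 0 2 :).mpr ⟨?_, fun c => ?_⟩
    · ext x y
      simp [K, ← hM.isHermitian.apply x y]
    · convert (RCLike.nonneg_iff.mp (hM.2 c)).1 using 2
      refine Finset.sum_congr rfl fun x _ => Finset.sum_congr rfl fun y _ => ?_
      simp only [K, Matrix.of_apply, smul_apply, one_apply_eq_self, smul_eq_mul,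
        RCLike.inner_apply, map_mul, hconj, RCLike.star_def]
      ring
  have : Fact K.PosSemidef := ⟨hK⟩
  refine ⟨RKHS.OfKernel K, inferInstance, inferInstance, inferInstance,
    fun x => RKHS.kerFun (RKHS.OfKernel K) x 1, fun x y => ?_, ?_⟩
  · rw [← RKHS.kernel_inner, RKHS.OfKernel.kernel_ofKernel]
    simp [K, hconj]
  · rw [Submodule.dense_iff_topologicalClosure_eq_top, eq_top_iff, ← RKHS.kerFun_dense]
    refine Submodule.topologicalClosure_mono (Submodule.span_le.mpr ?_)
    rintro _ ⟨x, z, rfl⟩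
    rw [← mul_one z, ← smul_eq_mul, map_smul]
    exact Submodule.smul_mem _ _ (Submodule.subset_span ⟨x, rfl⟩)

section DenseSpan

variable {X H H' : Type*} [NormedAddCommGroup H] [InnerProductSpace ℂ H]
  [NormedAddCommGroup H'] [InnerProductSpace ℂ H']

theorem exists_clm_of_norm_linearCombination_le [CompleteSpace H'] {v : X → H} {v' : X → H'}
    (hv : Dense (Submodule.span ℂ (Set.range v) : Set H)) {C : ℝ}
    (h : ∀ c, ‖Finsupp.linearCombination ℂ v' c‖ ≤ C * ‖Finsupp.linearCombination ℂ v c‖) :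
    ∃ T : H →L[ℂ] H', ∀ x, T (v x) = v' x := by
  have hdense : DenseRange (Finsupp.linearCombination ℂ v) := by
    rwa [DenseRange, ← LinearMap.coe_range, Finsupp.range_linearCombination]
  refine ⟨(Finsupp.linearCombination ℂ v').extendOfNorm (Finsupp.linearCombination ℂ v),
    fun x => ?_⟩
  simpa using LinearMap.extendOfNorm_eq hdense ⟨C, h⟩ (Finsupp.single x 1)

theorem exists_clm_of_inner_eq [CompleteSpace H'] {v : X → H} {v' : X → H'}
    (hv : Dense (Submodule.span ℂ (Set.range v) : Set H))
    (h : ∀ x y, inner ℂ (v' x) (v' y) = inner ℂ (v x) (v y)) :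
    ∃ T : H →L[ℂ] H', ∀ x, T (v x) = v' x := by
  refine exists_clm_of_norm_linearCombination_le hv (C := 1) fun c => ?_
  rw [one_mul, @norm_eq_sqrt_re_inner ℂ, @norm_eq_sqrt_re_inner ℂ,
    inner_linearCombination_eq_sum, inner_linearCombination_eq_sum]
  simp only [h, le_refl]

theorem clm_ext_of_inner_eq {v : X → H} (hv : Dense (Submodule.span ℂ (Set.range v) : Set H))
    {S T : H →L[ℂ] H} (h : ∀ x y, inner ℂ (v x) (S (v y)) = inner ℂ (v x) (T (v y))) :
    S = T := by
  refine ContinuousLinearMap.ext_on hv ?_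
  rintro _ ⟨y, rfl⟩
  refine ext_inner_right ℂ fun z => ?_
  have hfunctional : innerSL ℂ (S (v y)) = innerSL ℂ (T (v y)) := by
    refine ContinuousLinearMap.ext_on hv ?_
    rintro _ ⟨x, rfl⟩
    rw [innerSL_apply_apply, innerSL_apply_apply, ← inner_conj_symm, h, inner_conj_symm]
  simpa using congrArg (fun f => f z) hfunctional

end DenseSpan

/-- A matrix-valued function on a group is positive definite if the corresponding translation
invariant kernel is positive semidefinite. -/
def IsPosDefFun {Γ J : Type*} [Group Γ] (κ : J → J → Γ → ℂ) : Prop :=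
  (Matrix.of fun x y : Γ × J => κ x.2 y.2 (x.1⁻¹ * y.1)).PosSemidef

theorem norm_sq_eq_of_inner_self_eq {H : Type*} [NormedAddCommGroup H] [InnerProductSpace ℂ H]
    {v : H} {r : ℝ} (h : inner ℂ v v = (r : ℂ)) : ‖v‖ ^ 2 = r := by
  rw [inner_self_eq_norm_sq_to_K] at h
  have hcast : ((‖v‖ ^ 2 : ℝ) : ℂ) = r := by rw [Complex.ofReal_pow]; exact h
  exact_mod_cast hcast

namespace UnitaryRep

variable {G : Type u} [Group G]

theorem op_one (π : UnitaryRep G) : π.op 1 = 1 := by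
  rw [op, map_one, OneMemClass.coe_one]

theorem op_mul (π : UnitaryRep G) (x y : G) : π.op (x * y) = π.op x * π.op y := by
  rw [op, map_mul]
  rfl

theorem adjoint_op (π : UnitaryRep G) (x : G) :
    ContinuousLinearMap.adjoint (π.op x) = π.op x⁻¹ := by
  rw [← ContinuousLinearMap.star_eq_adjoint, op, op, ← Unitary.coe_star, Unitary.star_eq_inv,
    map_inv]

theorem inner_op_op (π : UnitaryRep G) (x y : G) (ξ η : π.H) :
    inner ℂ (π.op x ξ) (π.op y η) = inner ℂ ξ (π.op (x⁻¹ * y) η) := by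
  rw [← ContinuousLinearMap.adjoint_inner_right, adjoint_op, op_mul, mul_apply_eq_comp]

/-- The trivial representation on a one-dimensional space in the required universe. -/
noncomputable def trivial (G : Type u) [Group G] : UnitaryRep G where
  H := EuclideanSpace ℂ PUnit.{u + 1}
  hom := 1

end UnitaryRep

namespace IsPosDefFun

theorem of_inner {Γ J H : Type*} [Group Γ] [NormedAddCommGroup H] [InnerProductSpace ℂ H]
    {κ : J → J → Γ → ℂ} (v : Γ → J → H)
    (h : ∀ i j x y, κ i j (x⁻¹ * y) = inner ℂ (v x i) (v y j)) : IsPosDefFun κ :=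
  posSemidef_of_inner_eq (fun x : Γ × J => v x.1 x.2) fun _ _ => h _ _ _ _

theorem of_rep {G : Type u} [Group G] {J : Type*} (π : UnitaryRep G) (ζ : J → π.H) :
    IsPosDefFun fun i j g => inner ℂ (ζ i) (π.op g (ζ j)) :=
  of_inner (fun x i => π.op x (ζ i)) fun _ _ _ _ => (π.inner_op_op _ _ _ _).symm

section Operations

variable {Γ J : Type*} [Group Γ] {κ κ' : J → J → Γ → ℂ}

theorem mul (h : IsPosDefFun κ) (h' : IsPosDefFun κ') :
    IsPosDefFun fun i j g => κ i j g * κ' i j g :=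
  h.hadamard h'

theorem comp {Δ J' : Type*} [Group Δ] (h : IsPosDefFun κ) (φ : Δ →* Γ) (f : J' → J) :
    IsPosDefFun fun i j g => κ (f i) (f j) (φ g) := by
  have hsub := Matrix.PosSemidef.submatrix h fun x : Δ × J' => (φ x.1, f x.2)
  unfold IsPosDefFun
  convert hsub using 1
  ext x y
  simp only [Matrix.of_apply, Matrix.submatrix_apply, map_mul, map_inv]

theorem star_apply (h : IsPosDefFun κ) (i j : J) (γ : Γ) : star (κ i j γ) = κ j i γ⁻¹ := by
  simpa using Matrix.IsHermitian.apply (Matrix.PosSemidef.isHermitian h) (γ, j) (1, i)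

theorem apply_one_nonneg (h : IsPosDefFun κ) (i : J) : 0 ≤ κ i i 1 := by
  simpa using Matrix.PosSemidef.diag_nonneg h (i := (1, i))

end Operations

theorem exists_gns {Γ J : Type u} [Group Γ] {κ : J → J → Γ → ℂ} (h : IsPosDefFun κ) :
    ∃ (H : Type u) (_ : NormedAddCommGroup H) (_ : InnerProductSpace ℂ H) (_ : CompleteSpace H)
      (v : Γ × J → H) (ρ : Γ →* unitary (H →L[ℂ] H)),
        (∀ x y, inner ℂ (v x) (v y) = κ x.2 y.2 (x.1⁻¹ * y.1)) ∧
        (∀ g x, (ρ g : H →L[ℂ] H) (v x) = v (g * x.1, x.2)) ∧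
        Dense (Submodule.span ℂ (Set.range v) : Set H) := by
  obtain ⟨H, _, _, _, v, hv, hd⟩ := exists_gram_of_posSemidef h
  simp only [Matrix.of_apply] at hv
  have htranslate (g : Γ) : ∃ T : H →L[ℂ] H, ∀ x, T (v x) = v (g * x.1, x.2) :=
    exists_clm_of_inner_eq hd fun x y => by simp only [hv, mul_inv_rev, mul_assoc,
      inv_mul_cancel_left]
  choose T hT using htranslate
  have hone : T 1 = 1 := clm_ext_of_inner_eq hd fun x y => by
    rw [hT, one_mul, one_apply_eq_self]
  have hmul (g h : Γ) : T (g * h) = T g * T h := clm_ext_of_inner_eq hd fun x y => by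
    rw [hT, mul_apply_eq_comp, hT, hT, mul_assoc]
  have hstar (g : Γ) : star (T g) = T g⁻¹ := clm_ext_of_inner_eq hd fun x y => by
    rw [ContinuousLinearMap.star_eq_adjoint, ContinuousLinearMap.adjoint_inner_right, hT, hT,
      hv, hv]
    simp only [mul_inv_rev, mul_assoc]
  have hunitary (g : Γ) : T g ∈ unitary (H →L[ℂ] H) := by
    rw [Unitary.mem_iff, hstar, ← hmul, ← hmul, inv_mul_cancel, mul_inv_cancel, hone]
    exact ⟨rfl, rfl⟩
  exact ⟨H, inferInstance, inferInstance, inferInstance, v,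
    { toFun := fun g => ⟨T g, hunitary g⟩
      map_one' := Subtype.ext hone
      map_mul' := fun g h => Subtype.ext (hmul g h) }, hv, hT, hd⟩

theorem exists_rep {Γ : Type u} {J : Type*} [Small.{u} J] [Group Γ] {κ : J → J → Γ → ℂ}
    (h : IsPosDefFun κ) :
    ∃ (π : UnitaryRep Γ) (v : J → π.H), ∀ i j g, inner ℂ (v i) (π.op g (v j)) = κ i j g := by
  obtain ⟨H, _, _, _, v, ρ, hv, hρ, -⟩ :=
    (h.comp (MonoidHom.id Γ) (equivShrink.{u} J).symm).exists_gns
  rcases subsingleton_or_nontrivial H with hH | hH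
  · refine ⟨UnitaryRep.trivial Γ, 0, fun i j g => ?_⟩
    have hκ := hv (1, equivShrink J i) (g, equivShrink J j)
    rw [Subsingleton.elim (v _) 0, inner_zero_left] at hκ
    simpa using hκ
  · refine ⟨UnitaryRep.mk H ρ, fun j => v (1, equivShrink J j), fun i j g => ?_⟩
    refine (congrArg (inner ℂ _) (hρ g _)).trans ?_
    simp [hv]

end IsPosDefFun

theorem IsPosDefFun.universalNorm_mul_le {G : Type u} [Group G] {h : Fin 2 → Fin 2 → G → ℂ}
    (hh : IsPosDefFun h) {D : ℝ} (h0 : h 0 0 1 ≤ D) (h1 : h 1 1 1 ≤ D)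
    {ι : Type*} {m : ℕ} (s : Finset ι) (a : ι → Matrix (Fin m) (Fin m) ℂ) (g : ι → G) :
    universalNorm s (fun i => h 0 1 (g i) • a i) g ≤ D * universalNorm s a g := by
  have hD : 0 ≤ D := by exact_mod_cast (hh.apply_one_nonneg 0).trans h0
  rw [universalNorm_le_iff _ _ _ (mul_nonneg hD (universalNorm_nonneg s a g))]
  intro π ξ η
  let ζ : Fin 2 × Fin m → π.H := fun x => ![ξ x.2, η x.2] x.1
  obtain ⟨ρ, v, hv⟩ := ((of_rep π ζ).mul (hh.comp (MonoidHom.id G) Prod.fst)).exists_rep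
  have hnorm (x) : ‖v x‖ ^ 2 ≤ D * ‖ζ x‖ ^ 2 := by
    have hle : h x.1 x.1 1 ≤ D := by
      rcases x with ⟨k, p⟩; fin_cases k <;> assumption
    have hself : ((‖v x‖ ^ 2 : ℝ) : ℂ) = ((‖ζ x‖ ^ 2 : ℝ) : ℂ) * h x.1 x.1 1 := by
      simpa [UnitaryRep.op_one, inner_self_eq_norm_sq_to_K] using hv x x 1
    have hmul := mul_le_mul_of_nonneg_left hle
      (show (0 : ℂ) ≤ ((‖ζ x‖ ^ 2 : ℝ) : ℂ) by exact_mod_cast sq_nonneg ‖ζ x‖)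
    rw [mul_comm D]
    exact_mod_cast hself.trans_le hmul
  have hform : π.coeffForm s (fun i => h 0 1 (g i) • a i) g ξ η =
      ρ.coeffForm s a g (fun p => v (0, p)) fun q => v (1, q) := by
    unfold UnitaryRep.coeffForm
    refine Finset.sum_congr rfl fun p _ => Finset.sum_congr rfl fun q _ =>
      Finset.sum_congr rfl fun i _ => ?_
    simp only [hv, ζ, Matrix.smul_apply, smul_eq_mul, MonoidHom.id_apply, Matrix.cons_val_zero,
      Matrix.cons_val_one]
    ring
  have hmean : meanNormSq (fun p => v (0, p)) (fun q => v (1, q)) ≤ D * meanNormSq ξ η := by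
    rw [meanNormSq, meanNormSq, ← mul_div_assoc, mul_add, Finset.mul_sum, Finset.mul_sum]
    gcongr with p _ q _
    · exact hnorm (0, p)
    · exact hnorm (1, q)
  rw [hform]
  calc ‖ρ.coeffForm s a g (fun p => v (0, p)) fun q => v (1, q)‖
      ≤ universalNorm s a g * meanNormSq (fun p => v (0, p)) fun q => v (1, q) :=
        norm_coeffForm_le_universalNorm ..
    _ ≤ universalNorm s a g * (D * meanNormSq ξ η) := by
        gcongr; exact universalNorm_nonneg s a g
    _ = D * universalNorm s a g * meanNormSq ξ η := by ring

section BoundedCoefficients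

variable {G : Type u} [Group G] {m : ℕ}

theorem universalNorm_add_le {ι : Type*} (s : Finset ι) (a b : ι → Matrix (Fin m) (Fin m) ℂ)
    (g : ι → G) :
    universalNorm s (fun i => a i + b i) g ≤ universalNorm s a g + universalNorm s b g := by
  refine le_of_eq_of_le (congrArg norm ?_) (norm_add_le _ _)
  ext p q
  simp [matrixCoeffSum, Finset.sum_add_distrib, add_smul]

theorem universalNorm_smul {ι : Type*} (s : Finset ι) (c : ℂ) (a : ι → Matrix (Fin m) (Fin m) ℂ)
    (g : ι → G) : universalNorm s (fun i => c • a i) g = ‖c‖ * universalNorm s a g := by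
  rw [universalNorm, universalNorm, ← norm_smul]
  congr 1
  ext p q
  simp [matrixCoeffSum, Finset.smul_sum, mul_smul]

theorem universalNorm_sub_le {ι : Type*} (s : Finset ι) (a b : ι → Matrix (Fin m) (Fin m) ℂ)
    (g : ι → G) :
    universalNorm s (fun i => a i - b i) g ≤ universalNorm s a g + universalNorm s b g := by
  refine le_of_eq_of_le (congrArg norm ?_) (norm_sub_le _ _)
  ext p q
  simp [matrixCoeffSum, Finset.sum_sub_distrib, sub_smul]

theorem universalNorm_unimodular_smul_le {ι : Type u} (s : Finset ι)
    (a : ι → Matrix (Fin m) (Fin m) ℂ) (g : ι → G) {z : ι → ℂ} (hz : ∀ i, ‖z i‖ = 1) :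
    universalNorm s (fun i => z i • a i) g ≤ universalNorm s a FreeGroup.of := by
  rw [universalNorm_le_iff _ _ _ (universalNorm_nonneg _ _ _)]
  intro π ξ η
  have hunitary (i : ι) : z i • π.op (g i) ∈ unitary (π.H →L[ℂ] π.H) := by
    have hz' : star (z i) * z i = 1 := by
      rw [RCLike.star_def, ← Complex.normSq_eq_conj_mul_self, Complex.normSq_eq_norm_sq, hz]
      simp
    rw [Unitary.mem_iff, star_smul, smul_mul_smul_comm, smul_mul_smul_comm, hz',
      mul_comm (z i), hz']
    simp [UnitaryRep.op]
  let σ : UnitaryRep (FreeGroup ι) :=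
    UnitaryRep.mk π.H (FreeGroup.lift fun i => ⟨_, hunitary i⟩)
  have hform : π.coeffForm s (fun i => z i • a i) g ξ η = σ.coeffForm s a FreeGroup.of ξ η := by
    unfold UnitaryRep.coeffForm
    refine Finset.sum_congr rfl fun p _ => Finset.sum_congr rfl fun q _ =>
      Finset.sum_congr rfl fun i _ => ?_
    simp only [σ, UnitaryRep.op, FreeGroup.lift_apply_of, smul_apply, inner_smul_right,
      Matrix.smul_apply, smul_eq_mul]
    ring
  rw [hform]
  exact norm_coeffForm_le_universalNorm s a FreeGroup.of σ ξ η

theorem exists_unimodular_average {z : ℂ} (hz : ‖z‖ ≤ 1) :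
    ∃ u v : ℂ, ‖u‖ = 1 ∧ ‖v‖ = 1 ∧ z = (2⁻¹ : ℂ) * (u + v) := by
  refine ⟨Complex.exp ((z.arg + Real.arccos ‖z‖ : ℝ) * Complex.I),
    Complex.exp ((z.arg - Real.arccos ‖z‖ : ℝ) * Complex.I),
    Complex.norm_exp_ofReal_mul_I _, Complex.norm_exp_ofReal_mul_I _, ?_⟩
  have hcos : (‖z‖ : ℂ) = Complex.cos (Real.arccos ‖z‖ : ℝ) := by
    rw [← Complex.ofReal_cos, Real.cos_arccos (by linarith [norm_nonneg z]) hz]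
  conv_lhs => rw [← Complex.norm_mul_exp_arg_mul_I z, hcos, Complex.cos]
  push_cast
  rw [add_mul, sub_mul, Complex.exp_add, sub_eq_add_neg, Complex.exp_add, ← neg_mul]
  ring

theorem universalNorm_smul_le_of_norm_le {ι : Type u} (s : Finset ι)
    (a : ι → Matrix (Fin m) (Fin m) ℂ) (g : ι → G) {z : ι → ℂ} {δ : ℝ} (hδ : 0 < δ)
    (hz : ∀ i, ‖z i‖ ≤ δ) :
    universalNorm s (fun i => z i • a i) g ≤ δ * universalNorm s a FreeGroup.of := by
  have haverage (i : ι) : ∃ u v : ℂ, ‖u‖ = 1 ∧ ‖v‖ = 1 ∧ z i / δ = (2⁻¹ : ℂ) * (u + v) :=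
    exists_unimodular_average (by
      rw [norm_div, Complex.norm_real, Real.norm_of_nonneg hδ.le]
      exact div_le_one_of_le₀ (hz i) hδ.le)
  choose u v hu hv huv using haverage
  have hsplit (i : ι) : z i • a i = ((δ / 2 : ℝ) : ℂ) • (u i • a i + v i • a i) := by
    have hzi := huv i
    rw [div_eq_iff (by exact_mod_cast hδ.ne')] at hzi
    rw [← add_smul, smul_smul, hzi]
    push_cast
    ring_nf
  simp only [hsplit]
  rw [universalNorm_smul, Complex.norm_real, Real.norm_of_nonneg (by positivity)]
  calc δ / 2 * universalNorm s (fun i => u i • a i + v i • a i) g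
      ≤ δ / 2 * (universalNorm s a FreeGroup.of + universalNorm s a FreeGroup.of) := by
        gcongr
        exact (universalNorm_add_le ..).trans (add_le_add
          (universalNorm_unimodular_smul_le s a g hu) (universalNorm_unimodular_smul_le s a g hv))
    _ = δ * universalNorm s a FreeGroup.of := by ring

end BoundedCoefficients

/-! ### Residual finiteness of free groups -/

section ResiduallyFinite

theorem exists_perm_eq_mul {Γ : Type*} [Group Γ] (T : Finset Γ) (g : Γ) :
    ∃ τ : Equiv.Perm T, (∀ x, g * x.1 ∈ T → (τ x).1 = g * x.1) ∧
      ∀ x, g⁻¹ * x.1 ∈ T → (τ⁻¹ x).1 = g⁻¹ * x.1 := by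
  classical
  let e : {x : T // g * x.1 ∈ T} ≃ {y : T // g⁻¹ * y.1 ∈ T} :=
    { toFun := fun x => ⟨⟨g * x.1.1, x.2⟩, by simp⟩
      invFun := fun y => ⟨⟨g⁻¹ * y.1.1, y.2⟩, by simp⟩
      left_inv := fun x => by simp
      right_inv := fun y => by simp }
  have he (x : T) (hx : g * x.1 ∈ T) : (e.extendSubtype x).1 = g * x.1 :=
    congrArg Subtype.val (e.extendSubtype_apply_of_mem x hx)
  refine ⟨e.extendSubtype, he, fun y hy => ?_⟩
  suffices e.extendSubtype⁻¹ y = ⟨g⁻¹ * y.1, hy⟩ from congrArg Subtype.val this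
  rw [Equiv.Perm.inv_eq_iff_eq]
  refine Subtype.ext ?_
  rw [he _ (by simp), mul_inv_cancel_left]

theorem freeGroup_mk_cons {α : Type*} (x : α × Bool) (L : List (α × Bool)) :
    FreeGroup.mk (x :: L) = FreeGroup.mk [x] * FreeGroup.mk L := by
  rw [FreeGroup.mul_mk]; rfl

theorem freeGroup_mk_false {α : Type*} (a : α) :
    FreeGroup.mk [(a, false)] = (FreeGroup.of a)⁻¹ := by
  rw [FreeGroup.of, FreeGroup.inv_mk]; rfl

-- Left translation by a generator, restricted to the finite set of tails of a reduced word `w`,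
-- extends to a permutation; the resulting action moves the empty word through the tails to `w`.
instance {α : Type*} : Group.ResiduallyFinite (FreeGroup α) := by
  classical
  refine Group.residuallyFinite_of_forall_exists_finite_monoidHom fun w hw => ?_
  let T : Finset (FreeGroup α) := (w.toWord.tails.map FreeGroup.mk).toFinset
  have hT {L : List (α × Bool)} (hL : L <:+ w.toWord) : FreeGroup.mk L ∈ T := by
    simp only [T, List.mem_toFinset, List.mem_map, List.mem_tails]
    exact ⟨L, hL, rfl⟩
  choose τ hτ hτ_inv using fun a => exists_perm_eq_mul T (FreeGroup.of a)
  let σ : FreeGroup α →* Equiv.Perm T := FreeGroup.lift τ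
  have hσ (L : List (α × Bool)) (hL : L <:+ w.toWord) :
      (σ (FreeGroup.mk L) ⟨1, hT List.nil_suffix⟩).1 = FreeGroup.mk L := by
    induction L with
    | nil => rw [← FreeGroup.one_eq_mk, map_one]; rfl
    | cons x L ih =>
      have htail := ih ((List.suffix_cons x L).trans hL)
      have hmem := hT hL
      rw [freeGroup_mk_cons] at hmem ⊢
      rw [map_mul, Equiv.Perm.mul_apply]
      obtain ⟨a, _ | _⟩ := x
      · rw [freeGroup_mk_false] at hmem ⊢
        rw [map_inv, FreeGroup.lift_apply_of, hτ_inv _ _ (by rwa [htail]), htail]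
      · rw [← FreeGroup.of] at hmem ⊢
        rw [FreeGroup.lift_apply_of, hτ _ _ (by rwa [htail]), htail]
  refine ⟨Equiv.Perm T, inferInstance, inferInstance, σ, fun hσw => hw ?_⟩
  have h := hσ w.toWord (List.suffix_refl _)
  rw [FreeGroup.mk_toWord, hσw, Equiv.Perm.one_apply] at h
  exact h.symm

theorem exists_finiteIndexNormalSubgroup_forall_notMem {Γ : Type*} [Group Γ]
    [Group.ResiduallyFinite Γ] (S : Finset Γ) (hS : 1 ∉ S) :
    ∃ N : FiniteIndexNormalSubgroup Γ, ∀ w ∈ S, w ∉ N := by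
  classical
  induction S using Finset.induction_on with
  | empty => exact ⟨.ofSubgroup ⊤, by simp⟩
  | insert w S _ ih =>
    rw [Finset.mem_insert, not_or] at hS
    obtain ⟨N, hN⟩ := ih hS.2
    obtain ⟨M, hM⟩ := Group.exists_finiteIndexNormalSubgroup_notMem w (Ne.symm hS.1)
    refine ⟨M ⊓ N, Finset.forall_mem_insert _ _ _ |>.mpr
      ⟨fun h => hM h.1, fun x hx h => hN x hx h.2⟩⟩

theorem exists_finiteIndexNormalSubgroup_injOn {Γ : Type*} [Group Γ] [Group.ResiduallyFinite Γ]
    (W : Finset Γ) :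
    ∃ N : FiniteIndexNormalSubgroup Γ, Set.InjOn (QuotientGroup.mk' N.toSubgroup) W := by
  classical
  obtain ⟨N, hN⟩ := exists_finiteIndexNormalSubgroup_forall_notMem
    (((W ×ˢ W).image fun p => p.1⁻¹ * p.2).erase 1) (Finset.notMem_erase _ _)
  refine ⟨N, fun x hx y hy hxy => ?_⟩
  by_contra hne
  refine hN (x⁻¹ * y) (Finset.mem_erase.mpr ⟨by rwa [ne_eq, inv_mul_eq_one], ?_⟩)
    (QuotientGroup.eq.mp hxy)
  exact Finset.mem_image.mpr ⟨(x, y), Finset.mem_product.mpr ⟨hx, hy⟩, rfl⟩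

end ResiduallyFinite

/-! ### Positive definite functions on free groups -/

section TreeKernel

variable {β : Type*}

/-- The distance of two words in the rooted tree of all words, where the parent of a nonempty word
is obtained by deleting its last letter. -/
def treeDist [DecidableEq β] : List β → List β → ℕ
  | [], L => L.length
  | _ :: L, [] => L.length + 1
  | a :: L, b :: L' => if a = b then treeDist L L' else L.length + 1 + (L'.length + 1)

theorem posSemidef_of_forall_finset {X : Type*} {M : Matrix X X ℂ}
    (h : ∀ s : Finset X, ∃ N : Matrix X X ℂ, N.PosSemidef ∧ ∀ x ∈ s, ∀ y ∈ s, M x y = N x y) :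
    M.PosSemidef := by
  classical
  refine ⟨?_, fun c => ?_⟩
  · ext x y
    obtain ⟨N, hN, hMN⟩ := h {x, y}
    rw [Matrix.conjTranspose_apply, hMN y (by simp) x (by simp), hMN x (by simp) y (by simp)]
    exact hN.isHermitian.apply x y
  · obtain ⟨N, hN, hMN⟩ := h c.support
    convert hN.2 c using 1
    refine Finset.sum_congr rfl fun x hx => Finset.sum_congr rfl fun y hy => ?_
    dsimp only
    rw [hMN x hx y hy]

theorem posSemidef_star_mul {X : Type*} (f : X → ℂ) :
    (Matrix.of fun x y => star (f x) * f y).PosSemidef :=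
  posSemidef_of_inner_eq f fun x y => by simp [mul_comm]

/-- The kernel `r ^ treeDist L L' - r ^ (|L| + |L'|)`, truncated at depth `N`. It vanishes unless
`L` and `L'` start with the same letter, and removing that letter gives the recursion. -/
noncomputable def treeKernel [DecidableEq β] (r : ℝ) : ℕ → Matrix (List β) (List β) ℂ
  | 0 => 0
  | N + 1 =>
    (((1 : Matrix (Option β) (Option β) ℂ).submatrix List.head? List.head?) ⊙
      (treeKernel r N + ((1 - r ^ 2 : ℝ) : ℂ) • Matrix.of fun L L' : List β =>
        star ((r : ℂ) ^ L.length) * (r : ℂ) ^ L'.length).submatrix List.tail List.tail) ⊙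
      Matrix.of fun L L' : List β =>
        star (if L = [] then (0 : ℂ) else 1) * if L' = [] then 0 else 1

theorem posSemidef_treeKernel [DecidableEq β] {r : ℝ} (h0 : 0 ≤ r) (h1 : r ≤ 1) (N : ℕ) :
    (treeKernel (β := β) r N).PosSemidef := by
  induction N with
  | zero => exact Matrix.PosSemidef.zero
  | succ N ih =>
    have hr : (0 : ℂ) ≤ ((1 - r ^ 2 : ℝ) : ℂ) := by
      exact_mod_cast sub_nonneg.mpr (pow_le_one₀ h0 h1)
    exact ((Matrix.PosSemidef.one.submatrix _).hadamard
      ((ih.add ((posSemidef_star_mul _).smul hr)).submatrix _)).hadamard (posSemidef_star_mul _)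

theorem treeKernel_add [DecidableEq β] (r : ℝ) (N : ℕ) (L L' : List β) (hL : L.length ≤ N) :
    treeKernel r N L L' + star ((r : ℂ) ^ L.length) * (r : ℂ) ^ L'.length =
      (r : ℂ) ^ treeDist L L' := by
  induction N generalizing L L' with
  | zero =>
    obtain rfl : L = [] := by simpa using hL
    simp [treeKernel, treeDist]
  | succ N ih =>
    rcases L with _ | ⟨a, L⟩
    · simp [treeKernel, treeDist]
    rcases L' with _ | ⟨b, L'⟩
    · simp [treeKernel, treeDist]
    by_cases hab : a = b
    · subst hab
      rw [treeDist, if_pos rfl, ← ih L L' (by simpa using hL)]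
      simp [treeKernel, Matrix.one_apply]
      ring
    · simp [treeKernel, treeDist, hab, pow_add, Matrix.one_apply]

theorem posSemidef_pow_treeDist [DecidableEq β] {r : ℝ} (h0 : 0 ≤ r) (h1 : r ≤ 1) :
    (Matrix.of fun L L' : List β => (r : ℂ) ^ treeDist L L').PosSemidef := by
  refine posSemidef_of_forall_finset fun s => ⟨_, (posSemidef_treeKernel h0 h1
    (s.sup List.length)).add (posSemidef_star_mul fun L => (r : ℂ) ^ L.length),
    fun L hL L' _ => ?_⟩
  rw [Matrix.add_apply, Matrix.of_apply, Matrix.of_apply]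
  exact (treeKernel_add r _ L L' (Finset.le_sup hL)).symm

end TreeKernel

section FreeGroupMultiplier

/-- The homomorphism from the free group to `ℤ/3` that maps every generator to `1`. Among the words
of length less than two, the generators are exactly those of degree `1`. -/
def degreeModThree (α : Type*) : FreeGroup α →* Multiplicative (ZMod 3) :=
  FreeGroup.lift fun _ => Multiplicative.ofAdd 1

theorem degreeModThree_of {α : Type*} (t : α) :
    degreeModThree α (FreeGroup.of t) = Multiplicative.ofAdd 1 :=
  FreeGroup.lift_apply_of

variable {α : Type*} [DecidableEq α]

theorem norm_mk_inv_mul_mk_of_head_ne {a b : α × Bool} (hab : a ≠ b) {L L' : List (α × Bool)}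
    (hL : FreeGroup.IsReduced (a :: L)) (hL' : FreeGroup.IsReduced (b :: L')) :
    ((FreeGroup.mk (a :: L))⁻¹ * FreeGroup.mk (b :: L')).norm =
      L.length + 1 + (L'.length + 1) := by
  have hinv : FreeGroup.invRev (a :: L) = FreeGroup.invRev L ++ [(a.1, !a.2)] := by
    simp [FreeGroup.invRev]
  have hreduced : FreeGroup.IsReduced (FreeGroup.invRev (a :: L)) := by
    rw [FreeGroup.isReduced_iff_reduce_eq, FreeGroup.reduce_invRev, hL.reduce_eq]
  have hjunction : FreeGroup.IsReduced ([(a.1, !a.2)] ++ (b :: L')) := by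
    rw [List.singleton_append, FreeGroup.isReduced_cons_cons]
    refine ⟨fun h => ?_, hL'⟩
    by_contra hne
    refine hab (Prod.ext h ?_)
    revert hne
    cases a.2 <;> cases b.2 <;> simp
  rw [hinv] at hreduced
  rw [FreeGroup.inv_mk, FreeGroup.mul_mk, FreeGroup.norm, FreeGroup.toWord_mk, hinv,
    (hreduced.append_overlap hjunction (by simp)).reduce_eq]
  simp only [List.length_append, FreeGroup.invRev_length, List.length_cons, List.length_nil]

theorem norm_mk_inv_mul_mk_eq_treeDist (L L' : List (α × Bool)) (hL : FreeGroup.IsReduced L)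
    (hL' : FreeGroup.IsReduced L') :
    ((FreeGroup.mk L)⁻¹ * FreeGroup.mk L').norm = treeDist L L' := by
  induction L generalizing L' with
  | nil =>
    rw [← FreeGroup.one_eq_mk, inv_one, one_mul, FreeGroup.norm, FreeGroup.toWord_mk,
      hL'.reduce_eq, treeDist]
  | cons a L ih =>
    rcases L' with _ | ⟨b, L'⟩
    · rw [← FreeGroup.one_eq_mk, mul_one, FreeGroup.norm_inv_eq, FreeGroup.norm,
        FreeGroup.toWord_mk, hL.reduce_eq, treeDist, List.length_cons]
    rw [treeDist]
    split_ifs with hab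
    · subst hab
      rw [← ih L' (List.IsChain.tail hL) (List.IsChain.tail hL'), freeGroup_mk_cons a L,
        freeGroup_mk_cons a L', mul_inv_rev, mul_assoc, inv_mul_cancel_left]
    · exact norm_mk_inv_mul_mk_of_head_ne hab hL hL'

theorem isPosDefFun_pow_norm (J : Type*) {r : ℝ} (h0 : 0 ≤ r) (h1 : r ≤ 1) :
    IsPosDefFun fun (_ _ : J) (w : FreeGroup α) => (r : ℂ) ^ w.norm := by
  have hsub := (posSemidef_pow_treeDist (β := α × Bool) h0 h1).submatrix
    fun x : FreeGroup α × J => x.1.toWord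
  unfold IsPosDefFun
  convert hsub using 1
  ext x y
  simp only [Matrix.of_apply, Matrix.submatrix_apply]
  rw [← norm_mk_inv_mul_mk_eq_treeDist _ _ FreeGroup.isReduced_toWord FreeGroup.isReduced_toWord,
    FreeGroup.mk_toWord, FreeGroup.mk_toWord]

theorem isPosDefFun_indicator {Γ A J : Type*} [Group Γ] [CommGroup A] [DecidableEq A]
    (d : Γ →* A) (c : J → A) :
    IsPosDefFun fun i j w => if c i = c j * d w then (1 : ℂ) else 0 := by
  have hsub := (Matrix.PosSemidef.one (R := ℂ) (n := A)).submatrix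
    fun x : Γ × J => c x.2 * d x.1
  unfold IsPosDefFun
  convert hsub using 1
  ext x y
  simp only [Matrix.of_apply, Matrix.submatrix_apply, Matrix.one_apply, map_mul, map_inv]
  congr 1
  rw [eq_iff_iff, ← mul_left_inj (d x.1), mul_assoc]
  simp [mul_comm]

theorem two_le_norm_of_degreeModThree_eq {w : FreeGroup α}
    (hdeg : degreeModThree α w = Multiplicative.ofAdd 1) (hw : w ∉ Set.range FreeGroup.of) :
    2 ≤ w.norm := by
  by_contra! hlt
  have hlen : w.toWord.length < 2 := hlt
  rw [← FreeGroup.mk_toWord (x := w)] at hdeg hw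
  rcases hword : w.toWord with _ | ⟨⟨a, _ | _⟩, _ | ⟨_, _⟩⟩
  · rw [hword, ← FreeGroup.one_eq_mk, map_one] at hdeg
    exact absurd hdeg (by decide)
  · rw [hword, freeGroup_mk_false, map_inv, degreeModThree_of] at hdeg
    exact absurd hdeg (by decide)
  · simp [hword] at hlen
  · exact hw ⟨a, by rw [hword]; rfl⟩
  · simp [hword] at hlen

theorem exists_isPosDefFun_approx_indicator_generators {α : Type*} {r : ℝ}
    (h0 : 0 ≤ r) (h1 : r ≤ 1) :
    ∃ θ : Fin 2 → Fin 2 → FreeGroup α → ℂ, IsPosDefFun θ ∧ (∀ i, θ i i 1 = 1) ∧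
      (∀ t, θ 0 1 (FreeGroup.of t) = r) ∧
        ∀ w, w ∉ Set.range FreeGroup.of → ‖θ 0 1 w‖ ≤ r ^ 2 := by
  classical
  refine ⟨_, (isPosDefFun_indicator (degreeModThree α) ![Multiplicative.ofAdd 1, 1]).mul
    (isPosDefFun_pow_norm (Fin 2) h0 h1), fun i => by simp,
    fun t => by simp [degreeModThree_of], fun w hw => ?_⟩
  simp only [Matrix.cons_val_zero, Matrix.cons_val_one, one_mul]
  split_ifs with hdeg
  · rw [one_mul, norm_pow, Complex.norm_real, Real.norm_of_nonneg h0]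
    exact pow_le_pow_of_le_one h0 h1 (two_le_norm_of_degreeModThree_eq hdeg.symm hw)
  · simp [sq_nonneg]

end FreeGroupMultiplier

/-! ### Traces of translation invariant operators -/

section Orthogonal

variable {X H : Type*} [NormedAddCommGroup H] [InnerProductSpace ℂ H]

theorem norm_sq_sum_of_orthogonal (t : Finset X) (u : X → H)
    (h : ∀ x ∈ t, ∀ y ∈ t, x ≠ y → inner ℂ (u x) (u y) = 0) :
    ‖∑ x ∈ t, u x‖ ^ 2 = ∑ x ∈ t, ‖u x‖ ^ 2 := by
  classical
  induction t using Finset.induction_on with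
  | empty => simp
  | insert x t hx ih =>
    have horthogonal : inner ℂ (u x) (∑ y ∈ t, u y) = 0 := by
      rw [inner_sum]
      exact Finset.sum_eq_zero fun y hy => h x (Finset.mem_insert_self _ _) y
        (Finset.mem_insert_of_mem hy) (ne_of_mem_of_not_mem hy hx).symm
    rw [Finset.sum_insert hx, Finset.sum_insert hx, norm_add_sq (𝕜 := ℂ), horthogonal, ih]
    · simp
    · exact fun y hy z hz => h y (Finset.mem_insert_of_mem hy) z (Finset.mem_insert_of_mem hz)

theorem norm_sq_linearCombination_of_orthonormal {e : X → H} (he : Orthonormal ℂ e)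
    (c : X →₀ ℂ) : ‖Finsupp.linearCombination ℂ e c‖ ^ 2 = ∑ x ∈ c.support, ‖c x‖ ^ 2 := by
  rw [Finsupp.linearCombination_apply, Finsupp.sum, norm_sq_sum_of_orthogonal]
  · simp [norm_smul, he.1]
  · intro x _ y _ hxy
    rw [inner_smul_left, inner_smul_right, he.2 hxy, mul_zero, mul_zero]

variable {F A : Type*} [Fintype A]

theorem norm_sq_linearCombination_le_of_orthogonal_fibers {v : F × A → H} {D : ℝ}
    (hv : ∀ a w w', w ≠ w' → inner ℂ (v (w, a)) (v (w', a)) = 0) (hD : ∀ x, ‖v x‖ ^ 2 ≤ D)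
    (c : F × A →₀ ℂ) :
    ‖Finsupp.linearCombination ℂ v c‖ ^ 2 ≤
      Fintype.card A * D * ∑ x ∈ c.support, ‖c x‖ ^ 2 := by
  classical
  have hfiber (a : A) : ‖∑ x ∈ c.support with x.2 = a, c x • v x‖ ^ 2 ≤
      D * ∑ x ∈ c.support with x.2 = a, ‖c x‖ ^ 2 := by
    rw [norm_sq_sum_of_orthogonal, Finset.mul_sum]
    · refine Finset.sum_le_sum fun x _ => ?_
      rw [norm_smul, mul_pow, mul_comm]
      exact mul_le_mul_of_nonneg_right (hD x) (sq_nonneg _)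
    · rintro ⟨w, b⟩ hx ⟨w', b'⟩ hy hxy
      obtain rfl : b = a := (Finset.mem_filter.mp hx).2
      obtain rfl : b' = b := (Finset.mem_filter.mp hy).2
      rw [inner_smul_left, inner_smul_right, hv _ _ _ fun h => hxy (by rw [h]), mul_zero, mul_zero]
  calc ‖Finsupp.linearCombination ℂ v c‖ ^ 2
      = ‖∑ a, ∑ x ∈ c.support with x.2 = a, c x • v x‖ ^ 2 := by
        rw [Finsupp.linearCombination_apply, Finsupp.sum]
        exact congrArg (‖·‖ ^ 2) (Finset.sum_fiberwise _ _ _).symm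
    _ ≤ (∑ a, ‖∑ x ∈ c.support with x.2 = a, c x • v x‖) ^ 2 := by
        gcongr; exact norm_sum_le _ _
    _ ≤ Fintype.card A * ∑ a, ‖∑ x ∈ c.support with x.2 = a, c x • v x‖ ^ 2 :=
        sq_sum_le_card_mul_sum_sq
    _ ≤ Fintype.card A * ∑ a, D * ∑ x ∈ c.support with x.2 = a, ‖c x‖ ^ 2 := by
        gcongr with a _; exact hfiber a
    _ = Fintype.card A * D * ∑ x ∈ c.support, ‖c x‖ ^ 2 := by
        rw [← Finset.mul_sum, mul_assoc]
        congr 2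
        exact Finset.sum_fiberwise _ _ _

end Orthogonal

section HilbertBasis

variable {X E : Type*} [NormedAddCommGroup E] [InnerProductSpace ℂ E]

theorem dense_span_hilbertBasis (b : HilbertBasis X ℂ E) :
    Dense (Submodule.span ℂ (Set.range b) : Set E) :=
  Submodule.dense_iff_topologicalClosure_eq_top.mpr b.dense_span

variable [CompleteSpace E]

theorem exists_nonneg_clm_of_posSemidef {F A : Type*} [Finite A] (b : HilbertBasis (F × A) ℂ E)
    {K : Matrix (F × A) (F × A) ℂ} (hK : K.PosSemidef) {D : ℝ}
    (h0 : ∀ a w w', w ≠ w' → K (w, a) (w', a) = 0) (hD : ∀ x, K x x ≤ D) :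
    ∃ P : E →L[ℂ] E, 0 ≤ P ∧ ∀ x y, inner ℂ (b x) (P (b y)) = K x y := by
  cases nonempty_fintype A
  obtain ⟨H, _, _, _, v, hv, -⟩ := exists_gram_of_posSemidef hK
  have hnorm (x : F × A) : ‖v x‖ ^ 2 ≤ D := by
    have hx := hD x
    rw [← hv, inner_self_eq_norm_sq_to_K] at hx
    exact_mod_cast (Complex.ofReal_pow ‖v x‖ 2).trans_le hx
  have hbound (c : F × A →₀ ℂ) : ‖Finsupp.linearCombination ℂ v c‖ ≤
      √(Fintype.card A * D) * ‖Finsupp.linearCombination ℂ b c‖ := by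
    have hsq := norm_sq_linearCombination_le_of_orthogonal_fibers
      (fun a w w' hw => by rw [hv, h0 a w w' hw]) hnorm c
    rw [← norm_sq_linearCombination_of_orthonormal b.orthonormal] at hsq
    simpa [Real.sqrt_mul'] using Real.sqrt_le_sqrt hsq
  obtain ⟨W, hW⟩ := exists_clm_of_norm_linearCombination_le (dense_span_hilbertBasis b) hbound
  refine ⟨ContinuousLinearMap.adjoint W ∘L W, ?_, fun x y => ?_⟩
  · rw [ContinuousLinearMap.nonneg_iff_isPositive]
    exact ContinuousLinearMap.isPositive_adjoint_comp_self W
  · rw [ContinuousLinearMap.comp_apply, ContinuousLinearMap.adjoint_inner_right, hW, hW, hv]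

theorem tsum_prod_eq_sum_tsum {F A : Type*} [Fintype A] {f : F × A → ℂ} (hf : Summable f) :
    ∑' x, f x = ∑ a, ∑' w, f (w, a) := by
  have hf' : Summable fun x : A × F => f (Equiv.prodComm A F x) :=
    (Equiv.prodComm A F).summable_iff.mpr hf
  rw [← (Equiv.prodComm A F).tsum_eq f, hf'.tsum_prod, tsum_fintype]
  rfl

theorem inner_apply_apply_eq_sum_tsum {F A : Type*} [Fintype A] (b : HilbertBasis (F × A) ℂ E)
    (S T : E →L[ℂ] E) (x y : E) :
    inner ℂ x (S (T y)) = ∑ a, ∑' w, inner ℂ x (S (b (w, a))) * inner ℂ (b (w, a)) (T y) := by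
  rw [← ContinuousLinearMap.adjoint_inner_left, ← b.tsum_inner_mul_inner,
    tsum_prod_eq_sum_tsum (b.summable_inner_mul_inner _ _)]
  simp only [ContinuousLinearMap.adjoint_inner_left]

end HilbertBasis

section Trace

variable {F A E : Type*} [Group F] [NormedAddCommGroup E] [InnerProductSpace ℂ E]

/-- An operator on `ℓ²(F × A)` is translation invariant if its matrix is invariant under the left
translations of `F`. -/
def IsTranslationInvariant (b : HilbertBasis (F × A) ℂ E) (T : E →L[ℂ] E) : Prop :=
  ∀ (g : F) (x y : F × A),
    inner ℂ (b (g * x.1, x.2)) (T (b (g * y.1, y.2))) = inner ℂ (b x) (T (b y))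

theorem isTranslationInvariant_of_inner_eq {b : HilbertBasis (F × A) ℂ E} {T : E →L[ℂ] E}
    {κ : A → A → F → ℂ} (h : ∀ x y, inner ℂ (b x) (T (b y)) = κ x.2 y.2 (x.1⁻¹ * y.1)) :
    IsTranslationInvariant b T := fun g x y => by
  simp only [h, mul_inv_rev, mul_assoc, inv_mul_cancel_left]

variable [CompleteSpace E]

theorem exists_translation (b : HilbertBasis (F × A) ℂ E) (g : F) :
    ∃ U : E →L[ℂ] E, ∀ x, U (b x) = b (g * x.1, x.2) := by
  classical
  refine exists_clm_of_inner_eq (dense_span_hilbertBasis b) fun x y => ?_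
  simp only [orthonormal_iff_ite.mp b.orthonormal, Prod.ext_iff, mul_right_inj]

/-- The left translation by `g` on `ℓ²(F × A)`. -/
noncomputable def translation (b : HilbertBasis (F × A) ℂ E) (g : F) : E →L[ℂ] E :=
  (exists_translation b g).choose

theorem translation_apply (b : HilbertBasis (F × A) ℂ E) (g : F) (x : F × A) :
    translation b g (b x) = b (g * x.1, x.2) :=
  (exists_translation b g).choose_spec x

theorem adjoint_translation (b : HilbertBasis (F × A) ℂ E) (g : F) :
    ContinuousLinearMap.adjoint (translation b g) = translation b g⁻¹ := by
  classical
  refine clm_ext_of_inner_eq (dense_span_hilbertBasis b) fun x y => ?_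
  rw [ContinuousLinearMap.adjoint_inner_right, translation_apply, translation_apply]
  simp only [orthonormal_iff_ite.mp b.orthonormal, Prod.ext_iff, eq_inv_mul_iff_mul_eq]

theorem isTranslationInvariant_iff_commute {b : HilbertBasis (F × A) ℂ E} {T : E →L[ℂ] E} :
    IsTranslationInvariant b T ↔ ∀ g, Commute T (translation b g) := by
  have hcoeff (g : F) (x y : F × A) : inner ℂ (b x) ((translation b g * T) (b y)) =
      inner ℂ (b (g⁻¹ * x.1, x.2)) (T (b y)) := by
    rw [mul_apply_eq_comp, ← ContinuousLinearMap.adjoint_inner_left, adjoint_translation,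
      translation_apply]
  have hcoeff' (g : F) (x y : F × A) : inner ℂ (b x) ((T * translation b g) (b y)) =
      inner ℂ (b x) (T (b (g * y.1, y.2))) := by
    rw [mul_apply_eq_comp, translation_apply]
  refine ⟨fun h g => clm_ext_of_inner_eq (dense_span_hilbertBasis b) fun x y => ?_,
    fun h g x y => ?_⟩
  · rw [hcoeff, hcoeff', ← h g (g⁻¹ * x.1, x.2) y, mul_inv_cancel_left]
  · rw [← hcoeff', h g, hcoeff, inv_mul_cancel_left]

variable [Fintype A]

/-- The canonical trace on the algebra of translation invariant operators on `ℓ²(F × A)`. -/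
noncomputable def translationTrace (b : HilbertBasis (F × A) ℂ E) (T : E →L[ℂ] E) : ℂ :=
  ∑ a, inner ℂ (b (1, a)) (T (b (1, a)))

theorem translationTrace_mul (b : HilbertBasis (F × A) ℂ E) (S T : E →L[ℂ] E) :
    translationTrace b (S * T) =
      ∑ a, ∑ c, ∑' w, inner ℂ (b (1, a)) (S (b (w, c))) * inner ℂ (b (w, c)) (T (b (1, a))) :=
  Finset.sum_congr rfl fun _ _ => inner_apply_apply_eq_sum_tsum b S T _ _

theorem translationTrace_mul_comm {b : HilbertBasis (F × A) ℂ E} {S T : E →L[ℂ] E}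
    (hS : IsTranslationInvariant b S) (hT : IsTranslationInvariant b T) :
    translationTrace b (S * T) = translationTrace b (T * S) := by
  rw [translationTrace_mul, translationTrace_mul, Finset.sum_comm]
  refine Finset.sum_congr rfl fun c _ => Finset.sum_congr rfl fun a _ => ?_
  rw [← (Equiv.inv F).tsum_eq]
  refine tsum_congr fun w => ?_
  have hSw := hS w (1, a) (w⁻¹, c)
  have hTw := hT w (w⁻¹, c) (1, a)
  simp only [mul_one, mul_inv_cancel] at hSw hTw
  rw [Equiv.inv_apply, ← hSw, ← hTw, mul_comm]

theorem translationTrace_mul_nonneg {b : HilbertBasis (F × A) ℂ E} {P Q : E →L[ℂ] E}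
    (hP : 0 ≤ P) (hQ : 0 ≤ Q) (hP' : IsTranslationInvariant b P)
    (hQ' : IsTranslationInvariant b Q) : 0 ≤ translationTrace b (P * Q) := by
  let R : E →L[ℂ] E := CFC.sqrt Q
  have hRR : R * R = Q := CFC.sqrt_mul_sqrt_self Q hQ
  have hRsymm : ∀ x y, inner ℂ (R x) y = inner ℂ x (R y) :=
    ((ContinuousLinearMap.nonneg_iff_isPositive R).mp (CFC.sqrt_nonneg Q)).isSymmetric
  rw [isTranslationInvariant_iff_commute] at hP' hQ'
  have hR' (g : F) : Commute R (translation b g) := (hQ' g).cfcₙ_nnreal _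
  have htrace : translationTrace b (P * Q) = translationTrace b (R * (P * R)) := by
    rw [← hRR, ← mul_assoc]
    exact translationTrace_mul_comm
      (isTranslationInvariant_iff_commute.mpr fun g => (hP' g).mul_left (hR' g))
      (isTranslationInvariant_iff_commute.mpr hR')
  rw [htrace]
  refine Finset.sum_nonneg fun a _ => ?_
  rw [mul_apply_eq_comp, mul_apply_eq_comp, ← hRsymm]
  exact ((ContinuousLinearMap.nonneg_iff_isPositive P).mp hP).inner_nonneg_right _

end Trace

namespace IsPosDefFun

theorem of_star_mul {Γ J : Type*} [Group Γ] (f : J → ℂ) :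
    IsPosDefFun fun i j (_ : Γ) => star (f i) * f j :=
  posSemidef_star_mul fun x : Γ × J => f x.2

theorem of_translates {G F J : Type*} [Group G] [Group F] {s : J → J → G × F → ℂ}
    (h : IsPosDefFun s) (S : Finset (G × J)) :
    IsPosDefFun fun (x y : S) w => s x.1.2 y.1.2 (x.1.1⁻¹ * y.1.1, w) :=
  Matrix.PosSemidef.submatrix h fun x : F × S => ((x.2.1.1, x.1), x.2.1.2)

theorem exists_nonneg_clm {F A E : Type*} [Group F] [Finite A] [NormedAddCommGroup E]
    [InnerProductSpace ℂ E] [CompleteSpace E] (b : HilbertBasis (F × A) ℂ E)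
    {κ : A → A → F → ℂ} (h : IsPosDefFun κ) (h0 : ∀ a w, w ≠ 1 → κ a a w = 0) :
    ∃ P : E →L[ℂ] E, 0 ≤ P ∧ ∀ x y, inner ℂ (b x) (P (b y)) = κ x.2 y.2 (x.1⁻¹ * y.1) := by
  cases nonempty_fintype A
  have hdiag (a : A) : κ a a 1 ≤ ((∑ a, ‖κ a a 1‖ : ℝ) : ℂ) := by
    rw [← Complex.norm_of_nonneg' (h.apply_one_nonneg a)]
    exact_mod_cast Finset.single_le_sum (f := fun a => ‖κ a a 1‖)
      (fun _ _ => norm_nonneg _) (Finset.mem_univ a)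
  exact exists_nonneg_clm_of_posSemidef b h (D := ∑ a, ‖κ a a 1‖)
    (fun a w w' hw => h0 a _ fun h1 => hw (inv_mul_eq_one.mp h1))
    (fun x => by simpa using hdiag x.2)

theorem sum_tsum_mul_star_nonneg {F A : Type*} [Group F] [Fintype A] {κ κ' : A → A → F → ℂ}
    (h : IsPosDefFun κ) (h' : IsPosDefFun κ') (h0 : ∀ a w, w ≠ 1 → κ a a w = 0)
    (h0' : ∀ a w, w ≠ 1 → κ' a a w = 0) :
    0 ≤ ∑ a, ∑ b, ∑' w, κ a b w * star (κ' a b w) := by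
  let b : HilbertBasis (F × A) ℂ (lp (fun _ : F × A => ℂ) 2) :=
    HilbertBasis.ofRepr (LinearIsometryEquiv.refl ℂ _)
  obtain ⟨P, hP, hPκ⟩ := h.exists_nonneg_clm b h0
  obtain ⟨Q, hQ, hQκ⟩ := h'.exists_nonneg_clm b h0'
  have htrace := translationTrace_mul_nonneg hP hQ (isTranslationInvariant_of_inner_eq hPκ)
    (isTranslationInvariant_of_inner_eq hQκ)
  rw [translationTrace_mul] at htrace
  simpa only [hPκ, hQκ, h'.star_apply, inv_one, one_mul, mul_one] using htrace

theorem tsum_mul_star {G F J : Type*} [Group G] [Group F] {s s' : J → J → G × F → ℂ}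
    (hs : IsPosDefFun s) (hs' : IsPosDefFun s') (h0 : ∀ i w, w ≠ 1 → s i i (1, w) = 0)
    (h0' : ∀ i w, w ≠ 1 → s' i i (1, w) = 0) :
    IsPosDefFun fun i j γ => ∑' w, s i j (γ, w) * star (s' i j (γ, w)) := by
  refine ⟨?_, fun c => ?_⟩
  · ext x y
    rw [Matrix.conjTranspose_apply, Matrix.of_apply, Matrix.of_apply, RCLike.star_def,
      Complex.conj_tsum, ← (Equiv.inv F).tsum_eq]
    refine tsum_congr fun w => ?_
    rw [map_mul, ← RCLike.star_def, star_star, Equiv.inv_apply, hs.star_apply, hs'.star_apply,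
      Prod.inv_mk, mul_inv_rev, inv_inv, inv_inv]
    simp
  · have hκ := ((hs.of_translates c.support).mul (of_star_mul fun x : c.support => c x))
    have hnonneg := hκ.sum_tsum_mul_star_nonneg (hs'.of_translates c.support)
      (fun a w hw => by simp [h0 _ w hw]) (fun a w hw => by simp [h0' _ w hw])
    convert hnonneg using 1
    simp only [Finsupp.sum, Matrix.of_apply]
    rw [← Finset.sum_coe_sort]
    refine Finset.sum_congr rfl fun a _ => ?_
    rw [← Finset.sum_coe_sort]
    refine Finset.sum_congr rfl fun b _ => ?_
    rw [mul_right_comm, ← tsum_mul_left]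
    exact tsum_congr fun w => by ring

/-- Bessel's inequality: in vectors whose Gram matrix is the kernel of `κ`, those at the points
`(x w, j)` form an orthogonal family. -/
theorem sum_norm_sq_le {Γ J : Type*} [Group Γ] {κ : J → J → Γ → ℂ} (h : IsPosDefFun κ)
    {i j : J} {A B : ℝ} (hi : κ i i 1 = A) (hj : κ j j 1 = B) {W : Type*} {x : W → Γ}
    (hx : Pairwise fun w w' => κ j j ((x w)⁻¹ * x w') = 0) (T : Finset W) :
    ∑ w ∈ T, ‖κ i j (x w)‖ ^ 2 ≤ A * B := by
  obtain ⟨H, _, _, _, v, hv, -⟩ := exists_gram_of_posSemidef h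
  simp only [Matrix.of_apply] at hv
  let S := ∑ w ∈ T, ‖κ i j (x w)‖ ^ 2
  let u := ∑ w ∈ T, star (κ i j (x w)) • v (x w, j)
  have hS : 0 ≤ S := Finset.sum_nonneg fun _ _ => sq_nonneg _
  have hvi : ‖v (1, i)‖ ^ 2 = A := norm_sq_eq_of_inner_self_eq ((hv _ _).trans (by simpa using hi))
  have hvj (γ : Γ) : ‖v (γ, j)‖ ^ 2 = B :=
    norm_sq_eq_of_inner_self_eq ((hv _ _).trans (by simpa using hj))
  have hAB : 0 ≤ A * B := by rw [← hvi, ← hvj 1]; positivity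
  have hinner : inner ℂ (v (1, i)) u = S := by
    simp only [u, S, inner_sum, inner_smul_right, hv, inv_one, one_mul, RCLike.star_def,
      Complex.conj_mul', Complex.ofReal_sum, Complex.ofReal_pow]
  have hu : ‖u‖ ^ 2 = S * B := by
    rw [norm_sq_sum_of_orthogonal, Finset.sum_mul]
    · simp only [norm_smul, norm_star, mul_pow, hvj]
    · intro w _ w' _ hw
      rw [inner_smul_left, inner_smul_right, hv, hx hw, mul_zero, mul_zero]
  have hcauchy : S ^ 2 ≤ A * (S * B) := by
    have hle := norm_inner_le_norm (𝕜 := ℂ) (v (1, i)) u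
    rw [hinner, Complex.norm_of_nonneg hS] at hle
    calc S ^ 2 ≤ (‖v (1, i)‖ * ‖u‖) ^ 2 := by gcongr
      _ = A * (S * B) := by rw [mul_pow, hvi, hu]
  change S ≤ A * B
  by_contra! hlt
  nlinarith

end IsPosDefFun

/-! ### The Sidon inequality for matrix forms -/

section Sidon

variable {G ι : Type u} [Group G]

/-- The family `(U_G(g_i))` is completely Sidon with constant `C`. A family of unitaries being
bounded, only the norm inequality of `IsCompletelySidon` is required. -/
def IsSidonWith (C : ℝ) (g : ι → G) : Prop :=
  ∀ (m : ℕ) (s : Finset ι) (a : ι → Matrix (Fin m) (Fin m) ℂ),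
    universalNorm s a FreeGroup.of ≤ C * universalNorm s a g

theorem UnitaryRep.coeffForm_reindex {κ n n' : Type*} [Fintype n] [Fintype n'] (π : UnitaryRep G)
    (e : n ≃ n') (s : Finset κ) (a : κ → Matrix n n ℂ) (g : κ → G) (ξ η : n' → π.H) :
    π.coeffForm s (fun i => (a i).reindex e e) g ξ η = π.coeffForm s a g (ξ ∘ e) (η ∘ e) := by
  simp only [coeffForm, ← e.sum_comp, Matrix.reindex_apply, Matrix.submatrix_apply,
    Equiv.symm_apply_apply, Function.comp_apply]

theorem meanNormSq_comp_equiv {n n' H : Type*} [Fintype n] [Fintype n'] [NormedAddCommGroup H]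
    (e : n ≃ n') (ξ η : n' → H) : meanNormSq (ξ ∘ e) (η ∘ e) = meanNormSq ξ η := by
  simp only [meanNormSq, Function.comp_apply, e.sum_comp fun p => ‖ξ p‖ ^ 2,
    e.sum_comp fun q => ‖η q‖ ^ 2]

theorem IsSidonWith.norm_coeffForm_le {g : ι → G} {C : ℝ} (hg : IsSidonWith C g) (hC : 0 ≤ C)
    {n : Type*} [Fintype n] {s : Finset ι} {a : ι → Matrix n n ℂ}
    (h : ∀ (π : UnitaryRep G) (ξ η : n → π.H), ‖π.coeffForm s a g ξ η‖ ≤ meanNormSq ξ η)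
    (σ : UnitaryRep (FreeGroup ι)) (ξ η : n → σ.H) :
    ‖σ.coeffForm s a FreeGroup.of ξ η‖ ≤ C * meanNormSq ξ η := by
  let e := Fintype.equivFin n
  let a' (i : ι) := (a i).reindex e e
  have hG : universalNorm s a' g ≤ 1 :=
    (universalNorm_le_iff s a' g zero_le_one).mpr fun π ξ η => by
      rw [one_mul, π.coeffForm_reindex, ← meanNormSq_comp_equiv e]
      exact h π _ _
  have hfree : universalNorm s a' FreeGroup.of ≤ C :=
    (hg _ s a').trans (mul_le_of_le_one_right hC hG)
  have hσ := (universalNorm_le_iff s a' _ hC).mp hfree σ (ξ ∘ e.symm) (η ∘ e.symm)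
  rw [σ.coeffForm_reindex, meanNormSq_comp_equiv] at hσ
  simpa only [Function.comp_assoc, e.symm_comp_self, Function.comp_id] using hσ

end Sidon

section MatrixForms

variable {n H : Type*} [Fintype n] [NormedAddCommGroup H] [InnerProductSpace ℂ H]

/-- The quadratic form of `A ⊗ 1` on `H^n`. -/
noncomputable def matrixForm (A : Matrix n n ℂ) (ζ : n → H) : ℂ :=
  ∑ p, ∑ q, A p q * inner ℂ (ζ p) (ζ q)

/-- The action of a scalar matrix on `H^n`. -/
def matrixAct (S : Matrix n n ℂ) (ζ : n → H) : n → H := fun p => ∑ q, S p q • ζ q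

theorem matrixAct_mul (S T : Matrix n n ℂ) (ζ : n → H) :
    matrixAct (S * T) ζ = matrixAct S (matrixAct T ζ) := by
  funext p
  simp only [matrixAct, Finset.smul_sum, Matrix.mul_apply, Finset.sum_smul, smul_smul]
  rw [Finset.sum_comm]

theorem matrixAct_one [DecidableEq n] (ζ : n → H) : matrixAct (1 : Matrix n n ℂ) ζ = ζ := by
  funext p
  simp [matrixAct, Matrix.one_apply]

theorem sum_mul_inner_matrixAct (S T a : Matrix n n ℂ) (V : H →L[ℂ] H) (ξ η : n → H) :
    ∑ p, ∑ q, a p q * inner ℂ (matrixAct S ξ p) (V (matrixAct T η q)) =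
      ∑ p, ∑ q, (Sᴴ * a * T) p q * inner ℂ (ξ p) (V (η q)) := by
  have htrace (a f : Matrix n n ℂ) : ∑ p, ∑ q, a p q * f p q = (aᵀ * f).trace := by
    simp only [Matrix.trace, Matrix.diag_apply, Matrix.mul_apply, Matrix.transpose_apply]
    exact Finset.sum_comm
  let f : Matrix n n ℂ := Matrix.of fun p q => inner ℂ (ξ p) (V (η q))
  have hf : (Matrix.of fun p q => inner ℂ (matrixAct S ξ p) (V (matrixAct T η q))) =
      Sᴴᵀ * f * Tᵀ := by
    ext p q
    simp only [f, matrixAct, map_sum, map_smul, sum_inner, inner_sum, inner_smul_left,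
      inner_smul_right, Matrix.mul_apply, Matrix.transpose_apply, Matrix.conjTranspose_apply,
      Matrix.of_apply, Finset.sum_mul, Finset.mul_sum, RCLike.star_def]
    exact Finset.sum_congr rfl fun _ _ => Finset.sum_congr rfl fun _ _ => by ring
  calc ∑ p, ∑ q, a p q * inner ℂ (matrixAct S ξ p) (V (matrixAct T η q))
      = (aᵀ * (Sᴴᵀ * f * Tᵀ)).trace := by rw [← hf, ← htrace]; rfl
    _ = ((Sᴴ * a * T)ᵀ * f).trace := by
        rw [Matrix.transpose_mul, Matrix.transpose_mul, ← mul_assoc, ← mul_assoc,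
          Matrix.trace_mul_comm, ← mul_assoc, ← mul_assoc]
    _ = ∑ p, ∑ q, (Sᴴ * a * T) p q * inner ℂ (ξ p) (V (η q)) := by rw [← htrace]; rfl

theorem matrixForm_one [DecidableEq n] (ζ : n → H) :
    matrixForm (1 : Matrix n n ℂ) ζ = ((∑ p, ‖ζ p‖ ^ 2 : ℝ) : ℂ) := by
  simp [matrixForm, Matrix.one_apply]

theorem matrixForm_conjTranspose_mul_self (S : Matrix n n ℂ) (ζ : n → H) :
    matrixForm (Sᴴ * S) ζ = ((∑ p, ‖matrixAct S ζ p‖ ^ 2 : ℝ) : ℂ) := by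
  classical
  rw [← matrixForm_one]
  simpa only [matrixForm, mul_one, ContinuousLinearMap.id_apply] using
    (sum_mul_inner_matrixAct S S 1 (ContinuousLinearMap.id ℂ H) ζ ζ).symm

theorem matrixForm_add_conjTranspose_add_smul_one [DecidableEq n] (A : Matrix n n ℂ) (δ : ℝ)
    (ζ : n → H) : matrixForm (A + Aᴴ + (δ : ℂ) • 1) ζ =
      ((2 * (matrixForm A ζ).re + δ * ∑ p, ‖ζ p‖ ^ 2 : ℝ) : ℂ) := by
  have hstar : matrixForm Aᴴ ζ = star (matrixForm A ζ) := by
    simp only [matrixForm, star_sum, star_mul', RCLike.star_def, inner_conj_symm,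
      Matrix.conjTranspose_apply]
    rw [Finset.sum_comm]
  have hadd : matrixForm (A + Aᴴ + (δ : ℂ) • 1) ζ =
      matrixForm A ζ + matrixForm Aᴴ ζ + δ * matrixForm 1 ζ := by
    simp only [matrixForm, Finset.mul_sum, ← Finset.sum_add_distrib, Matrix.add_apply,
      Matrix.smul_apply, smul_eq_mul, add_mul, mul_assoc]
  rw [hadd, hstar, matrixForm_one, RCLike.star_def, Complex.add_conj]
  push_cast
  ring

theorem matrixForm_smul_const (A : Matrix n n ℂ) (c : n → ℂ) (x : H) :
    matrixForm A (fun p => c p • x) = star c ⬝ᵥ (A *ᵥ c) * (‖x‖ : ℂ) ^ 2 := by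
  simp only [matrixForm, inner_smul_left, inner_smul_right, dotProduct, Matrix.mulVec,
    Finset.mul_sum, Finset.sum_mul, Pi.star_apply, inner_self_eq_norm_sq_to_K, RCLike.star_def]
  exact Finset.sum_congr rfl fun p _ => Finset.sum_congr rfl fun q _ => by
    ring!

theorem matrixForm_const_smul (A : Matrix n n ℂ) (z : ℂ) (ζ : n → H) :
    matrixForm A (fun p => z • ζ p) = ‖z‖ ^ 2 * matrixForm A ζ := by
  simp only [matrixForm, inner_smul_left, inner_smul_right, Finset.mul_sum, ← Complex.conj_mul']
  exact Finset.sum_congr rfl fun p _ => Finset.sum_congr rfl fun q _ => by ring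

theorem meanNormSq_matrixAct [DecidableEq n] {A B S T : Matrix n n ℂ} {δ : ℝ}
    (hS : Sᴴ * S = A + Aᴴ + (δ : ℂ) • 1) (hT : Tᴴ * T = B + Bᴴ + (δ : ℂ) • 1) (ξ η : n → H) :
    meanNormSq (matrixAct S ξ) (matrixAct T η) =
      (matrixForm A ξ).re + (matrixForm B η).re + δ * meanNormSq ξ η := by
  have hξ := matrixForm_conjTranspose_mul_self S ξ
  have hη := matrixForm_conjTranspose_mul_self T η
  rw [hS, matrixForm_add_conjTranspose_add_smul_one, Complex.ofReal_inj] at hξ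
  rw [hT, matrixForm_add_conjTranspose_add_smul_one, Complex.ofReal_inj] at hη
  rw [meanNormSq, meanNormSq, ← hξ, ← hη]
  ring

theorem exists_units_conjTranspose_mul_self [DecidableEq n] [Nontrivial H] {A : Matrix n n ℂ}
    (hA : ∀ ζ : n → H, 0 ≤ (matrixForm A ζ).re) {δ : ℝ} (hδ : 0 < δ) :
    ∃ S : (Matrix n n ℂ)ˣ, (S : Matrix n n ℂ)ᴴ * S = A + Aᴴ + (δ : ℂ) • 1 := by
  obtain ⟨x, hx⟩ := exists_norm_eq H zero_le_one
  have hpos : (A + Aᴴ + (δ : ℂ) • 1).PosDef := by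
    refine Matrix.PosDef.of_dotProduct_mulVec_pos ?_ fun c hc => ?_
    · simp [Matrix.IsHermitian, Matrix.conjTranspose_add, Matrix.conjTranspose_smul, add_comm]
    · obtain ⟨p, hp⟩ := Function.ne_iff.mp hc
      have hsum : 0 < ∑ p, ‖c p • x‖ ^ 2 := by
        refine Finset.sum_pos' (fun _ _ => sq_nonneg _) ⟨p, Finset.mem_univ _, ?_⟩
        rw [norm_smul, hx, mul_one]
        exact pow_pos (norm_pos_iff.mpr hp) 2
      have hform := matrixForm_add_conjTranspose_add_smul_one A δ fun p => c p • x
      rw [matrixForm_smul_const, hx, Complex.ofReal_one, one_pow, mul_one] at hform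
      rw [hform]
      exact_mod_cast add_pos_of_nonneg_of_pos (mul_nonneg zero_le_two (hA _)) (mul_pos hδ hsum)
  open scoped MatrixOrder in
  obtain ⟨S, hS⟩ := CStarAlgebra.nonneg_iff_eq_star_mul_self.mp hpos.posSemidef.nonneg
  have hunit : IsUnit (star S * S) := hS ▸ hpos.isUnit
  rw [Matrix.isUnit_iff_isUnit_det, Matrix.det_mul] at hunit
  exact ⟨((Matrix.isUnit_iff_isUnit_det S).mpr (isUnit_of_mul_isUnit_right hunit)).unit, hS.symm⟩

end MatrixForms

theorem nonneg_of_forall_pos_nonneg_add_mul {X Y : ℝ} (h : ∀ δ > 0, 0 ≤ X + δ * Y) : 0 ≤ X := by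
  have hlim : Filter.Tendsto (fun δ => X + δ * Y) (nhdsWithin 0 (Set.Ioi 0)) (nhds X) := by
    have hcont : Continuous fun δ : ℝ => X + δ * Y := by fun_prop
    simpa using (hcont.tendsto 0).mono_left nhdsWithin_le_nhds
  exact ge_of_tendsto hlim (Filter.eventually_of_mem self_mem_nhdsWithin h)

section OperatorSystem

variable {G : Type u} [Group G] {n : Type*} [Fintype n]

namespace UnitaryRep

variable {κ : Type*} (π : UnitaryRep G) (s : Finset κ) (a : κ → Matrix n n ℂ) (g : κ → G)

theorem coeffForm_matrixAct (S T : Matrix n n ℂ) (ξ η : n → π.H) :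
    π.coeffForm s a g (matrixAct S ξ) (matrixAct T η) =
      π.coeffForm s (fun i => Sᴴ * a i * T) g ξ η := by
  have hswap (b : κ → Matrix n n ℂ) (ξ η : n → π.H) : π.coeffForm s b g ξ η =
      ∑ i ∈ s, ∑ p, ∑ q, b i p q * inner ℂ (ξ p) (π.op (g i) (η q)) := by
    rw [coeffForm, Finset.sum_comm (s := s)]
    exact Finset.sum_congr rfl fun p _ => Finset.sum_comm
  rw [hswap, hswap]
  exact Finset.sum_congr rfl fun i _ => sum_mul_inner_matrixAct S T (a i) _ ξ η

theorem coeffForm_smul_right (z : ℂ) (ξ η : n → π.H) :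
    π.coeffForm s a g ξ (fun q => z • η q) = z * π.coeffForm s a g ξ η := by
  simp only [coeffForm, map_smul, inner_smul_right, Finset.mul_sum, mul_left_comm]

theorem norm_coeffForm_le_of_re_nonneg {A B : Matrix n n ℂ}
    (h : ∀ ξ η : n → π.H,
      0 ≤ (matrixForm A ξ).re + (matrixForm B η).re + (π.coeffForm s a g ξ η).re)
    (ξ η : n → π.H) :
    ‖π.coeffForm s a g ξ η‖ ≤ (matrixForm A ξ).re + (matrixForm B η).re := by
  obtain ⟨z, hz, hzform⟩ := RCLike.exists_norm_eq_mul_self (K := ℂ) (π.coeffForm s a g ξ η)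
  have hre := h ξ fun q => (-z) • η q
  rw [coeffForm_smul_right, matrixForm_const_smul, norm_neg, hz, neg_mul, ← hzform] at hre
  simp only [Complex.ofReal_one, one_pow, one_mul, Complex.neg_re] at hre
  have hnorm : ((algebraMap ℝ ℂ) ‖π.coeffForm s a g ξ η‖).re = ‖π.coeffForm s a g ξ η‖ :=
    Complex.ofReal_re _
  linarith

end UnitaryRep

/-- Since `S ⊗ 1` and `T ⊗ 1` commute with the representations, conjugating by them, where
`Sᴴ * S = A + Aᴴ + δ` and `Tᴴ * T = B + Bᴴ + δ`, reduces the claim to contractions. -/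
theorem IsSidonWith.norm_coeffForm_le_matrixForm {ι : Type u} {g : ι → G} {C : ℝ}
    (hg : IsSidonWith C g) (hC : 0 ≤ C) {s : Finset ι} {a : ι → Matrix n n ℂ}
    {A B : Matrix n n ℂ}
    (h : ∀ (π : UnitaryRep G) (ξ η : n → π.H),
      ‖π.coeffForm s a g ξ η‖ ≤ (matrixForm A ξ).re + (matrixForm B η).re)
    (σ : UnitaryRep (FreeGroup ι)) (ξ η : n → σ.H) :
    ‖σ.coeffForm s a FreeGroup.of ξ η‖ ≤ C * ((matrixForm A ξ).re + (matrixForm B η).re) := by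
  classical
  have hA (ξ : n → (UnitaryRep.trivial G).H) : 0 ≤ (matrixForm A ξ).re := by
    simpa [matrixForm] using (norm_nonneg _).trans (h _ ξ 0)
  have hB (η : n → (UnitaryRep.trivial G).H) : 0 ≤ (matrixForm B η).re := by
    simpa [matrixForm] using (norm_nonneg _).trans (h _ 0 η)
  rw [← sub_nonneg]
  refine nonneg_of_forall_pos_nonneg_add_mul (Y := C * meanNormSq ξ η) fun δ hδ => ?_
  obtain ⟨S, hS⟩ := exists_units_conjTranspose_mul_self hA hδ
  obtain ⟨T, hT⟩ := exists_units_conjTranspose_mul_self hB hδ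
  have hcontraction (π : UnitaryRep G) (ξ η : n → π.H) :
      ‖π.coeffForm s (fun i => (↑S⁻¹ : Matrix n n ℂ)ᴴ * a i * (↑T⁻¹ : Matrix n n ℂ)) g ξ η‖ ≤
        meanNormSq ξ η := by
    rw [← π.coeffForm_matrixAct]
    have hle := h π (matrixAct ↑S⁻¹ ξ) (matrixAct ↑T⁻¹ η)
    have hST := meanNormSq_matrixAct hS hT (matrixAct (↑S⁻¹ : Matrix n n ℂ) ξ)
      (matrixAct (↑T⁻¹ : Matrix n n ℂ) η)
    rw [← matrixAct_mul, ← matrixAct_mul, S.mul_inv, T.mul_inv, matrixAct_one,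
      matrixAct_one] at hST
    have hnonneg := mul_nonneg hδ.le
      (meanNormSq_nonneg (matrixAct (↑S⁻¹ : Matrix n n ℂ) ξ) (matrixAct (↑T⁻¹ : Matrix n n ℂ) η))
    linarith
  have hfree := hg.norm_coeffForm_le hC hcontraction σ (matrixAct S ξ) (matrixAct T η)
  rw [← σ.coeffForm_matrixAct, ← matrixAct_mul, ← matrixAct_mul, S.inv_mul, T.inv_mul,
    matrixAct_one, matrixAct_one, meanNormSq_matrixAct hS hT] at hfree
  linarith

end OperatorSystem

/-! ### Extension of positive functionals -/

section Extension

variable {Γ J : Type*}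

/-- The linear functional on `M_J(ℂ[Γ])` with matrix of coefficients `κ`. -/
noncomputable def coeffFunctional (κ : J → J → Γ → ℂ) : (J × J × Γ →₀ ℂ) →ₗ[ℂ] ℂ :=
  Finsupp.linearCombination ℂ fun y => κ y.1 y.2.1 y.2.2

theorem coeffFunctional_single (κ : J → J → Γ → ℂ) (y : J × J × Γ) (z : ℂ) :
    coeffFunctional κ (Finsupp.single y z) = z * κ y.1 y.2.1 y.2.2 :=
  Finsupp.linearCombination_single ℂ z y

theorem coeffFunctional_apply (κ : J → J → Γ → ℂ) (x : J × J × Γ →₀ ℂ) :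
    coeffFunctional κ x = ∑ y ∈ x.support, x y * κ y.1 y.2.1 y.2.2 :=
  Finsupp.linearCombination_apply ℂ x

theorem exists_re_coeffFunctional_eq (Φ : (J × J × Γ →₀ ℂ) →ₗ[ℝ] ℝ) :
    ∃ s : J → J → Γ → ℂ, ∀ x, (coeffFunctional s x).re = Φ x := by
  let Ψ : (J × J × Γ →₀ ℂ) →ₗ[ℂ] ℂ := Module.Dual.extendRCLike Φ
  have hΨ : coeffFunctional (fun i j γ => Ψ (Finsupp.single (i, j, γ) 1)) = Ψ :=
    Finsupp.lhom_ext fun y z => by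
      rw [coeffFunctional_single, ← smul_eq_mul, ← map_smul, Finsupp.smul_single, smul_eq_mul,
        mul_one]
  refine ⟨fun i j γ => Ψ (Finsupp.single (i, j, γ) 1), fun x => ?_⟩
  rw [hΨ]
  exact Module.Dual.re_extendRCLike_apply (𝕜 := ℂ) Φ x

variable [Group Γ]

/-- The cone of elements of `M_J(ℂ[Γ])` on which the real parts of all positive definite functions
are nonnegative. -/
noncomputable def dualCone (J Γ : Type*) [Group Γ] : PointedCone ℝ (J × J × Γ →₀ ℂ) where
  carrier := {x | ∀ κ : J → J → Γ → ℂ, IsPosDefFun κ → 0 ≤ (coeffFunctional κ x).re}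
  add_mem' hx hy κ hκ := by
    rw [map_add, Complex.add_re]
    exact add_nonneg (hx κ hκ) (hy κ hκ)
  zero_mem' κ _ := by rw [map_zero, Complex.zero_re]
  smul_mem' r x hx κ hκ := by
    have hsmul : coeffFunctional κ (r • x) = (r : ℝ) • coeffFunctional κ x :=
      (coeffFunctional κ).map_smul_of_tower (r : ℝ) x
    rw [hsmul, Complex.smul_re]
    exact mul_nonneg r.2 (hx κ hκ)

theorem mem_dualCone {x : J × J × Γ →₀ ℂ} :
    x ∈ dualCone J Γ ↔ ∀ κ : J → J → Γ → ℂ, IsPosDefFun κ → 0 ≤ (coeffFunctional κ x).re :=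
  Iff.rfl

theorem re_coeffFunctional_eq_zero {s : J → J → Γ → ℂ}
    (h : ∀ x ∈ dualCone J Γ, 0 ≤ (coeffFunctional s x).re) {x : J × J × Γ →₀ ℂ}
    (hx : ∀ κ : J → J → Γ → ℂ, IsPosDefFun κ → (coeffFunctional κ x).re = 0) :
    (coeffFunctional s x).re = 0 := by
  refine le_antisymm ?_ (h x fun κ hκ => (hx κ hκ).ge)
  simpa using h (-x) fun κ hκ => by simp [hx κ hκ]

theorem isPosDefFun_of_nonneg_on_dualCone {s : J → J → Γ → ℂ}
    (h : ∀ x ∈ dualCone J Γ, 0 ≤ (coeffFunctional s x).re) : IsPosDefFun s := by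
  have hsymm (i j : J) (γ : Γ) (z : ℂ) : (z * s i j γ).re = (star z * s j i γ⁻¹).re := by
    have hdiff (κ : J → J → Γ → ℂ) :
        (coeffFunctional κ (Finsupp.single (i, j, γ) z - Finsupp.single (j, i, γ⁻¹) (star z))).re =
          (z * κ i j γ).re - (star z * κ j i γ⁻¹).re := by
      rw [map_sub, coeffFunctional_single, coeffFunctional_single, Complex.sub_re]
    rw [← sub_eq_zero, ← hdiff]
    refine re_coeffFunctional_eq_zero h fun κ hκ => ?_
    rw [hdiff, ← hκ.star_apply, ← star_mul', RCLike.star_def, Complex.conj_re, sub_self]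
  have hstar (i j : J) (γ : Γ) : star (s j i γ⁻¹) = s i j γ :=
    Complex.ext (by simpa using (hsymm i j γ 1).symm)
      (by simpa using congrArg Neg.neg (hsymm i j γ Complex.I).symm)
  refine ⟨?_, fun c => ?_⟩
  · ext x y
    rw [Matrix.conjTranspose_apply, Matrix.of_apply, Matrix.of_apply, ← hstar x.2 y.2, mul_inv_rev,
      inv_inv]
  · let x := c.sum fun x cx => c.sum fun y cy =>
      Finsupp.single (x.2, y.2, x.1⁻¹ * y.1) (star cx * cy)
    have hx (κ : J → J → Γ → ℂ) : coeffFunctional κ x =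
        c.sum fun x cx => c.sum fun y cy => star cx * κ x.2 y.2 (x.1⁻¹ * y.1) * cy := by
      simp only [x, Finsupp.sum, map_sum, coeffFunctional_single, mul_right_comm]
    have hnonneg (κ : J → J → Γ → ℂ) (hκ : IsPosDefFun κ) : 0 ≤ coeffFunctional κ x :=
      hx κ ▸ hκ.2 c
    have him : (coeffFunctional s x).im = 0 := by
      simpa using re_coeffFunctional_eq_zero h (x := Complex.I • x) fun κ hκ => by
        simp [← (Complex.nonneg_iff.mp (hnonneg κ hκ)).2]
    simp only [Matrix.of_apply]
    rw [← hx, Complex.nonneg_iff]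
    exact ⟨h x fun κ hκ => (Complex.nonneg_iff.mp (hnonneg κ hκ)).1, him.symm⟩

theorem IsPosDefFun.norm_apply_le_sum [Fintype J] {κ : J → J → Γ → ℂ} (h : IsPosDefFun κ)
    (i j : J) (γ : Γ) : ‖κ i j γ‖ ≤ ∑ k, (κ k k 1).re := by
  have hreal (k : J) : κ k k 1 = (κ k k 1).re := Complex.eq_re_of_ofReal_le (h.apply_one_nonneg k)
  have hnonneg (k : J) : 0 ≤ (κ k k 1).re := (Complex.nonneg_iff.mp (h.apply_one_nonneg k)).1
  have hle (k : J) : (κ k k 1).re ≤ ∑ k, (κ k k 1).re :=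
    Finset.single_le_sum (f := fun k => (κ k k 1).re) (fun k _ => hnonneg k) (Finset.mem_univ k)
  have hsq := h.sum_norm_sq_le (hreal i) (hreal j) (x := fun _ : Unit => γ) (Subsingleton.pairwise)
    Finset.univ
  rw [Fintype.sum_unique] at hsq
  refine le_of_sq_le_sq (hsq.trans ?_) ((hnonneg i).trans (hle i))
  rw [sq]
  exact mul_le_mul (hle i) (hle j) (hnonneg j) ((hnonneg i).trans (hle i))

theorem smul_sum_single_add_mem_dualCone [Fintype J] (x : J × J × Γ →₀ ℂ) :
    ((∑ y ∈ x.support, ‖x y‖ : ℝ) : ℂ) • ∑ i, Finsupp.single (i, i, 1) 1 + x ∈ dualCone J Γ := by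
  refine mem_dualCone.mpr fun κ hκ => ?_
  have hunit : coeffFunctional κ (∑ i, Finsupp.single (i, i, 1) 1) = ∑ i, κ i i 1 := by
    simp only [map_sum, coeffFunctional_single, one_mul]
  have hbound : ‖coeffFunctional κ x‖ ≤ (∑ y ∈ x.support, ‖x y‖) * ∑ i, (κ i i 1).re := by
    rw [coeffFunctional_apply, Finset.sum_mul]
    refine norm_sum_le_of_le _ fun y _ => ?_
    rw [norm_mul]
    exact mul_le_mul_of_nonneg_left (hκ.norm_apply_le_sum _ _ _) (norm_nonneg _)
  rw [map_add, map_smul, hunit, smul_eq_mul, Complex.add_re, Complex.re_ofReal_mul, Complex.re_sum]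
  linarith [(abs_le.mp ((Complex.abs_re_le_norm _).trans hbound)).1]

/-- A positive functional on the operator system spanned by `Z` extends by M. Riesz's theorem: the
diagonal units dominate every element. -/
theorem exists_isPosDefFun_extension [Finite J] {Z : Set (J × J × Γ)}
    (hZ : ∀ i, (i, i, 1) ∈ Z) (φ : J → J → Γ → ℂ)
    (h : ∀ x ∈ dualCone J Γ, ↑x.support ⊆ Z → 0 ≤ (coeffFunctional φ x).re) :
    ∃ s : J → J → Γ → ℂ, IsPosDefFun s ∧ ∀ i j γ, (i, j, γ) ∈ Z → s i j γ = φ i j γ := by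
  cases nonempty_fintype J
  let f : (J × J × Γ →₀ ℂ) →ₗ.[ℝ] ℝ :=
    { domain := (Finsupp.supported ℂ ℂ Z).restrictScalars ℝ
      toFun := Complex.reLm ∘ₗ (coeffFunctional φ).restrictScalars ℝ ∘ₗ Submodule.subtype _ }
  have hunit : ∑ i, Finsupp.single (i, i, 1) 1 ∈ Finsupp.supported ℂ ℂ Z :=
    Submodule.sum_mem _ fun i _ => Finsupp.single_mem_supported ℂ _ (hZ i)
  obtain ⟨Φ, hΦ, hpos⟩ := riesz_extension (dualCone J Γ) f
    (fun x hx => h x hx ((Finsupp.mem_supported ℂ _).mp x.2))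
    fun x => ⟨⟨_, Submodule.smul_mem _ _ hunit⟩, smul_sum_single_add_mem_dualCone x⟩
  obtain ⟨s, hs⟩ := exists_re_coeffFunctional_eq Φ
  refine ⟨s, isPosDefFun_of_nonneg_on_dualCone fun x hx => hs x ▸ hpos x hx,
    fun i j γ hy => ?_⟩
  have hre (z : ℂ) : (z * s i j γ).re = (z * φ i j γ).re := by
    rw [← coeffFunctional_single s (i, j, γ), hs,
      hΦ ⟨_, Finsupp.single_mem_supported ℂ z hy⟩]
    exact congrArg Complex.re (coeffFunctional_single φ _ z)
  exact Complex.ext (by simpa using hre 1) (by simpa using hre Complex.I)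

end Extension

section FiniteQuotient

variable {W K : Type*} [Group K] [Fintype K]

/-- The image of `f` in the left regular representation of `K`, where `σ : W → K`. -/
noncomputable def translationMatrix [DecidableEq K] (σ : W → K) (f : W →₀ ℂ) : Matrix K K ℂ :=
  Matrix.of fun p q => f.sum fun w z => z * if p = σ w * q then 1 else 0

theorem sum_translationMatrix_mul [DecidableEq K] (σ : W → K) (f : W →₀ ℂ) (Ξ : K → K → ℂ) :
    ∑ p, ∑ q, translationMatrix σ f p q * Ξ p q = f.sum fun w z => z * ∑ q, Ξ (σ w * q) q := by
  simp only [translationMatrix, Matrix.of_apply, Finsupp.sum, Finset.sum_mul, Finset.mul_sum]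
  rw [Finset.sum_comm, Finset.sum_congr rfl fun q _ => Finset.sum_comm, Finset.sum_comm]
  exact Finset.sum_congr rfl fun w _ => Finset.sum_congr rfl fun q _ => by simp

theorem matrixForm_translationMatrix [DecidableEq K] {H : Type*}
    [NormedAddCommGroup H] [InnerProductSpace ℂ H] (σ : W → K) (f : W →₀ ℂ) (ζ : K → H) :
    matrixForm (translationMatrix σ f) ζ =
      f.sum fun w z => z * ∑ q, inner ℂ (ζ (σ w * q)) (ζ q) :=
  sum_translationMatrix_mul σ f _

theorem IsPosDefFun.sum_inner_regular {G F : Type*} [Group G] [Group F] {J : Type*}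
    (σ : F →* K) (π : UnitaryRep G) (ζ : J → K → π.H) :
    IsPosDefFun fun i j (γ : G × F) => ∑ q, inner ℂ (ζ i (σ γ.2 * q)) (π.op γ.1 (ζ j q)) := by
  refine IsPosDefFun.of_inner (H := PiLp 2 fun _ : K => π.H) (fun x j => WithLp.toLp 2 fun p =>
    π.op x.1 (ζ j ((σ x.2)⁻¹ * p))) fun i j x y => ?_
  rw [PiLp.inner_apply]
  refine Fintype.sum_equiv (Equiv.mulLeft (σ y.2)) _ _ fun q => ?_
  simp [UnitaryRep.inner_op_op, mul_assoc]

theorem UnitaryRep.coeffForm_translationMatrix [DecidableEq K] {G : Type*} [Group G] {κ : Type*}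
    (π : UnitaryRep G) (σ : W → K) (s : Finset κ) (c : κ → W →₀ ℂ) (g : κ → G) (ξ η : K → π.H) :
    π.coeffForm s (fun i => translationMatrix σ (c i)) g ξ η =
      ∑ i ∈ s, (c i).sum fun w z => z * ∑ q, inner ℂ (ξ (σ w * q)) (π.op (g i) (η q)) := by
  rw [coeffForm, Finset.sum_congr rfl fun p _ => Finset.sum_comm, Finset.sum_comm]
  exact Finset.sum_congr rfl fun i _ => sum_translationMatrix_mul σ (c i) _

end FiniteQuotient

theorem exists_regular_rep {F K : Type u} [Group F] [Group K] [DecidableEq K] (σ : F →* K) :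
    ∃ (ρ : UnitaryRep F) (e : K → ρ.H), ∀ p q w,
      inner ℂ (e p) (ρ.op w (e q)) = if p = σ w * q then 1 else 0 := by
  refine IsPosDefFun.exists_rep (κ := fun p q w => if p = σ w * q then 1 else 0) ?_
  have hsub := (Matrix.PosSemidef.one (n := K) (R := ℂ)).submatrix fun x : F × K => σ x.1 * x.2
  unfold IsPosDefFun
  convert hsub using 1
  ext x y
  simp [Matrix.one_apply, eq_inv_mul_iff_mul_eq, mul_assoc]

theorem sum_mul_sum_inner_regular {F K : Type u} [Group F] [Group K] [Fintype K] [DecidableEq K]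
    {σ : F →* K} {ρ : UnitaryRep F} {e : K → ρ.H}
    (he : ∀ p q w, inner ℂ (e p) (ρ.op w (e q)) = if p = σ w * q then 1 else 0)
    {f : F →₀ ℂ} {v : F} (hσ : Set.InjOn σ (insert v f.support)) :
    (f.sum fun w z => z * ∑ q, inner ℂ (e (σ w * q)) (ρ.op v (e q))) = Fintype.card K * f v := by
  classical
  have hterm (w : F) (hw : w ∈ f.support) : f w * ∑ q, inner ℂ (e (σ w * q)) (ρ.op v (e q)) =
      if w = v then Fintype.card K * f v else 0 := by
    have hiff : σ w = σ v ↔ w = v :=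
      hσ.eq_iff (Set.mem_insert_of_mem v hw) (Set.mem_insert v _)
    simp only [he, mul_left_inj, hiff]
    split_ifs with h
    · simp [h, mul_comm]
    · simp
  rw [Finsupp.sum, Finset.sum_congr rfl hterm, Finset.sum_ite_eq' f.support v]
  split_ifs with hv
  · rfl
  · rw [Finsupp.notMem_support_iff.mp hv, mul_zero]

section SidonExtension

variable {G ι : Type u}

/-- The coefficients of the functional that is `C` times the canonical trace of `C*(F)` on the
diagonal and, off the diagonal, maps `U_G(g t) ⊗ U_w` to `1` if `w` is the generator `t` and to `0`
otherwise. -/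
noncomputable def sidonValues (C : ℝ) (g : ι → G) (i j : Fin 2) (γ : G × FreeGroup ι) : ℂ :=
  open Classical in
  if i = j then if γ.2 = 1 then C else 0 else if ∃ t, γ = (g t, FreeGroup.of t) then 1 else 0

theorem sidonValues_diag_of_ne (C : ℝ) (g : ι → G) (i : Fin 2) (γ : G) {w : FreeGroup ι}
    (hw : w ≠ 1) : sidonValues C g i i (γ, w) = 0 := by
  simp [sidonValues, hw]

theorem sidonValues_diag_one (C : ℝ) (g : ι → G) (i : Fin 2) (γ : G) :
    sidonValues C g i i (γ, 1) = C := by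
  simp [sidonValues]

theorem sidonValues_corner (C : ℝ) (g : ι → G) (t : ι) :
    sidonValues C g 0 1 (g t, FreeGroup.of t) = 1 := by
  rw [sidonValues, if_neg (by decide), if_pos ⟨t, rfl⟩]

theorem sidonValues_corner_of_ne (C : ℝ) {g : ι → G} (hg : Function.Injective g) {t : ι}
    {w : FreeGroup ι} (hw : w ≠ FreeGroup.of t) : sidonValues C g 0 1 (g t, w) = 0 := by
  rw [sidonValues, if_neg (by decide), if_neg]
  rintro ⟨t', h⟩
  exact hw (by rw [(Prod.mk.inj h).2, hg (Prod.mk.inj h).1])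

theorem sum_mul_sidonValues_diag (C : ℝ) (g : ι → G) (i : Fin 2) (γ : G)
    (f : FreeGroup ι →₀ ℂ) :
    (f.sum fun w z => z * sidonValues C g i i (γ, w)) = C * f 1 := by
  rw [Finsupp.sum_eq_single 1 (fun w _ hw => by rw [sidonValues_diag_of_ne C g i γ hw, mul_zero])
    fun _ => zero_mul _, sidonValues_diag_one, mul_comm]

theorem sum_mul_sidonValues_corner (C : ℝ) {g : ι → G} (hg : Function.Injective g) (t : ι)
    (f : FreeGroup ι →₀ ℂ) :
    (f.sum fun w z => z * sidonValues C g 0 1 (g t, w)) = f (FreeGroup.of t) := by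
  rw [Finsupp.sum_eq_single (FreeGroup.of t)
    (fun w _ hw => by rw [sidonValues_corner_of_ne C hg hw, mul_zero]) fun _ => zero_mul _,
    sidonValues_corner, mul_one]

variable [Group G]

/-- The index set of the elementary tensors that span the operator system with diagonal entries in
`C*(F)` and upper right entry in `span {U_G(g t)} ⊗ C*(F)`. -/
def sidonSystem (F : Type*) [Group F] (g : ι → G) : Set (Fin 2 × Fin 2 × G × F) :=
  {y | (y.1 = y.2.1 ∧ y.2.2.1 = 1) ∨ (y.1 = 0 ∧ y.2.1 = 1 ∧ ∃ t, g t = y.2.2.1)}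

theorem exists_coeffFunctional_eq_of_support_subset {F : Type*} [Group F] {g : ι → G}
    {x : Fin 2 × Fin 2 × G × F →₀ ℂ} (hx : ↑x.support ⊆ sidonSystem F g) :
    ∃ (b : Fin 2 → F →₀ ℂ) (c : ι →₀ F →₀ ℂ), ∀ κ : Fin 2 → Fin 2 → G × F → ℂ,
      coeffFunctional κ x = (∑ i, (b i).sum fun w z => z * κ i i (1, w)) +
        c.sum fun t f => f.sum fun w z => z * κ 0 1 (g t, w) := by
  classical
  have hspan := (Finsupp.mem_supported ℂ x).mpr hx
  rw [Finsupp.supported_eq_span_single] at hspan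
  clear hx
  induction hspan using Submodule.span_induction with
  | zero => exact ⟨0, 0, fun κ => by simp⟩
  | mem y hy =>
    obtain ⟨⟨i, j, γ, w⟩, hy, rfl⟩ := hy
    rcases hy with ⟨hij, hγ⟩ | ⟨hi, hj, t, ht⟩
    · dsimp only at hij hγ
      subst hij hγ
      refine ⟨Pi.single i (Finsupp.single w 1), 0, fun κ => ?_⟩
      fin_cases i <;> simp [coeffFunctional_single]
    · dsimp only at hi hj ht
      subst hi hj ht
      refine ⟨0, Finsupp.single t (Finsupp.single w 1), fun κ => ?_⟩
      rw [coeffFunctional_single, Finsupp.sum_single_index, Finsupp.sum_single_index] <;> simp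
  | add x y _ _ ihx ihy =>
    obtain ⟨b, c, hbc⟩ := ihx
    obtain ⟨b', c', hbc'⟩ := ihy
    refine ⟨b + b', c + c', fun κ => ?_⟩
    have hadd (f f' : F →₀ ℂ) (χ : F → ℂ) : ((f + f').sum fun w z => z * χ w) =
        (f.sum fun w z => z * χ w) + f'.sum fun w z => z * χ w :=
      Finsupp.sum_add_index' (by simp) fun _ _ _ => add_mul _ _ _
    rw [map_add, hbc, hbc', Finsupp.sum_add_index' (by simp) fun t f f' => hadd f f' _]
    simp only [Pi.add_apply, hadd, Finset.sum_add_distrib]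
    exact add_add_add_comm _ _ _ _
  | smul z x _ ih =>
    obtain ⟨b, c, hbc⟩ := ih
    refine ⟨z • b, z • c, fun κ => ?_⟩
    have hsmul (f : F →₀ ℂ) (χ : F → ℂ) :
        ((z • f).sum fun w z => z * χ w) = z * f.sum fun w z => z * χ w := by
      rw [Finsupp.sum_smul_index (by simp), Finsupp.mul_sum]
      simp only [mul_assoc]
    rw [map_smul, hbc, Finsupp.sum_smul_index' (by simp)]
    simp only [Pi.smul_apply, hsmul, smul_eq_mul, mul_add, Finset.mul_sum, Finsupp.mul_sum]

theorem re_matrixForm_add_re_coeffForm_nonneg {F K : Type*} [Group F] [Group K] [Fintype K]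
    [DecidableEq K] {g : ι → G} {x : Fin 2 × Fin 2 × G × F →₀ ℂ}
    (hx : x ∈ dualCone (Fin 2) (G × F)) {b : Fin 2 → F →₀ ℂ} {c : ι →₀ F →₀ ℂ}
    (hbc : ∀ κ, coeffFunctional κ x = (∑ i, (b i).sum fun w z => z * κ i i (1, w)) +
      c.sum fun t f => f.sum fun w z => z * κ 0 1 (g t, w))
    (σ : F →* K) (π : UnitaryRep G) (ξ η : K → π.H) :
    0 ≤ (matrixForm (translationMatrix σ (b 0)) ξ).re +
      (matrixForm (translationMatrix σ (b 1)) η).re +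
      (π.coeffForm c.support (fun t => translationMatrix σ (c t)) g ξ η).re := by
  have hκ := mem_dualCone.mp hx _ (IsPosDefFun.sum_inner_regular σ π ![ξ, η])
  rw [hbc, Fin.sum_univ_two] at hκ
  simpa only [matrixForm_translationMatrix, π.coeffForm_translationMatrix, Finsupp.sum,
    π.op_one, Complex.add_re, Matrix.cons_val_zero, Matrix.cons_val_one,
    one_apply_eq_self] using hκ

/-- A finite quotient of the free group, acting on the matrix coefficients, turns the element into
forms of the kind controlled by the Sidon hypothesis. -/
theorem IsSidonWith.re_sum_nonneg {g : ι → G} {C : ℝ} (hg : IsSidonWith C g) (hC : 0 ≤ C)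
    {x : Fin 2 × Fin 2 × G × FreeGroup ι →₀ ℂ} (hx : x ∈ dualCone (Fin 2) (G × FreeGroup ι))
    {b : Fin 2 → FreeGroup ι →₀ ℂ} {c : ι →₀ FreeGroup ι →₀ ℂ}
    (hbc : ∀ κ, coeffFunctional κ x = (∑ i, (b i).sum fun w z => z * κ i i (1, w)) +
      c.sum fun t f => f.sum fun w z => z * κ 0 1 (g t, w)) :
    0 ≤ (C * (b 0 1 + b 1 1) + c.sum fun t f => f (FreeGroup.of t)).re := by
  classical
  obtain ⟨N, hN⟩ := exists_finiteIndexNormalSubgroup_injOn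
    ((Finset.univ.biUnion fun i => insert 1 (b i).support) ∪
      c.support.biUnion fun t => insert (FreeGroup.of t) (c t).support)
  let K := FreeGroup ι ⧸ N.toSubgroup
  let σ : FreeGroup ι →* K := QuotientGroup.mk' N.toSubgroup
  have : Fintype K := Fintype.ofFinite K
  have hσ_diag (i : Fin 2) : Set.InjOn σ (insert 1 (b i).support) := by
    rw [← Finset.coe_insert]
    exact hN.mono <| Finset.coe_subset.mpr <| (Finset.subset_biUnion_of_mem
      (fun i => insert 1 (b i).support) (Finset.mem_univ i)).trans Finset.subset_union_left
  have hσ_corner (t : ι) (ht : t ∈ c.support) :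
      Set.InjOn σ (insert (FreeGroup.of t) (c t).support) := by
    rw [← Finset.coe_insert]
    exact hN.mono <| Finset.coe_subset.mpr <| (Finset.subset_biUnion_of_mem
      (fun t => insert (FreeGroup.of t) (c t).support) ht).trans Finset.subset_union_right
  obtain ⟨ρ, e, he⟩ := exists_regular_rep σ
  have hform (i : Fin 2) : matrixForm (translationMatrix σ (b i)) e = Fintype.card K * b i 1 := by
    rw [matrixForm_translationMatrix, ← sum_mul_sum_inner_regular he (hσ_diag i), ρ.op_one]
    rfl
  have hcorner : ρ.coeffForm c.support (fun t => translationMatrix σ (c t)) FreeGroup.of e e =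
      Fintype.card K * c.sum fun t f => f (FreeGroup.of t) := by
    rw [ρ.coeffForm_translationMatrix, Finsupp.mul_sum]
    exact Finset.sum_congr rfl fun t ht => sum_mul_sum_inner_regular he (hσ_corner t ht)
  have hle := hg.norm_coeffForm_le_matrixForm hC
    (fun π => π.norm_coeffForm_le_of_re_nonneg _ _ g
      (re_matrixForm_add_re_coeffForm_nonneg hx hbc σ π)) ρ e e
  have hfree := neg_le_of_abs_le ((Complex.abs_re_le_norm _).trans hle)
  rw [hform, hform, hcorner, ← Complex.ofReal_natCast, Complex.re_ofReal_mul,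
    Complex.re_ofReal_mul, Complex.re_ofReal_mul] at hfree
  rw [Complex.add_re, Complex.re_ofReal_mul, Complex.add_re]
  have hcard : (0 : ℝ) < Fintype.card K := by exact_mod_cast Fintype.card_pos
  exact nonneg_of_mul_nonneg_right (by linarith) hcard

/-- On `sidonSystem` the Sidon hypothesis is the positivity of `sidonValues`. -/
theorem IsSidonWith.exists_isPosDefFun {g : ι → G} {C : ℝ} (hS : IsSidonWith C g)
    (hg : Function.Injective g) (hC : 0 ≤ C) :
    ∃ s : Fin 2 → Fin 2 → G × FreeGroup ι → ℂ, IsPosDefFun s ∧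
      (∀ i, s i i 1 = C) ∧ (∀ i w, w ≠ 1 → s i i (1, w) = 0) ∧
      (∀ t, s 0 1 (g t, FreeGroup.of t) = 1) ∧
      ∀ t w, w ≠ FreeGroup.of t → s 0 1 (g t, w) = 0 := by
  have hdiag (i : Fin 2) (w : FreeGroup ι) : (i, i, (1, w)) ∈ sidonSystem (FreeGroup ι) g :=
    Or.inl ⟨rfl, rfl⟩
  have hcorner (t : ι) (w : FreeGroup ι) : (0, 1, (g t, w)) ∈ sidonSystem (FreeGroup ι) g :=
    Or.inr ⟨rfl, rfl, t, rfl⟩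
  obtain ⟨s, hs, hsZ⟩ := exists_isPosDefFun_extension (fun i => hdiag i 1) (sidonValues C g)
    fun x hx hxZ => by
      obtain ⟨b, c, hbc⟩ := exists_coeffFunctional_eq_of_support_subset hxZ
      have hnonneg := hS.re_sum_nonneg hC hx hbc
      simpa only [hbc, sum_mul_sidonValues_diag, sum_mul_sidonValues_corner C hg,
        Fin.sum_univ_two, ← mul_add] using hnonneg
  exact ⟨s, hs, fun i => (hsZ _ _ _ (hdiag i 1)).trans (sidonValues_diag_one C g i 1),
    fun i w hw => (hsZ _ _ _ (hdiag i w)).trans (sidonValues_diag_of_ne C g i 1 hw),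
    fun t => (hsZ _ _ _ (hcorner t _)).trans (sidonValues_corner C g t),
    fun t w hw => (hsZ _ _ _ (hcorner t w)).trans (sidonValues_corner_of_ne C hg hw)⟩

end SidonExtension

/-! ### Interpolation and unions -/

section Interpolation

/-- The sum of the weights `θ i j w * ‖s i j (γ, w)‖ ^ 2` over the fibre of `φ` at `γ`. -/
noncomputable def fiberSum {G F J : Type*} [Group G] [Group F] (φ : F →* G) (θ : J → J → F → ℂ)
    (s : J → J → G × F → ℂ) (i j : J) (γ : G) : ℂ :=
  open Classical in
  ∑' w, s i j (γ, w) * (if φ w = γ then 1 else 0) * θ i j w * star (s i j (γ, w))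

section FiberSum

variable {G F J : Type*} [Group G] [Group F] (φ : F →* G) {θ : J → J → F → ℂ}
  {s : J → J → G × F → ℂ}

theorem isPosDefFun_graph [DecidableEq G] :
    IsPosDefFun fun (_ _ : J) (γ : G × F) => if φ γ.2 = γ.1 then (1 : ℂ) else 0 := by
  have hsub := (Matrix.PosSemidef.one (n := G) (R := ℂ)).submatrix
    fun x : (G × F) × J => x.1.1 * (φ x.1.2)⁻¹
  unfold IsPosDefFun
  convert hsub using 1
  ext x y
  simp only [Matrix.of_apply, Matrix.submatrix_apply, Matrix.one_apply, Prod.snd_mul,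
    Prod.fst_mul, Prod.snd_inv, Prod.fst_inv, map_mul, map_inv]
  congr 1
  rw [eq_iff_iff, eq_mul_inv_iff_mul_eq, mul_assoc]
  exact eq_inv_mul_iff_mul_eq

theorem IsPosDefFun.fiberSum (hs : IsPosDefFun s) (hθ : IsPosDefFun θ)
    (h0 : ∀ i w, w ≠ 1 → s i i (1, w) = 0) : IsPosDefFun (fiberSum φ θ s) := by
  classical
  exact ((hs.mul (isPosDefFun_graph φ)).mul (hθ.comp (MonoidHom.snd G F) id)).tsum_mul_star hs
    (fun i w hw => by simp [h0 i w hw]) h0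

theorem fiberSum_eq_of_forall_ne {i j : J} {γ : G} {v : F} (hv : φ v = γ)
    (h : ∀ w, w ≠ v → s i j (γ, w) = 0) :
    fiberSum φ θ s i j γ = θ i j v * ‖s i j (γ, v)‖ ^ 2 := by
  rw [fiberSum, tsum_eq_single v fun w hw => by simp [h w hw], if_pos hv, ← Complex.mul_conj',
    RCLike.star_def]
  ring

theorem norm_fiberSum_le {i j : J} {γ : G} {δ B : ℝ} (hδ : 0 ≤ δ)
    (hθ : ∀ w, φ w = γ → ‖θ i j w‖ ≤ δ) (hB : ∀ T : Finset F, ∑ w ∈ T, ‖s i j (γ, w)‖ ^ 2 ≤ B) :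
    ‖fiberSum φ θ s i j γ‖ ≤ δ * B := by
  have hsum : Summable fun w => ‖s i j (γ, w)‖ ^ 2 :=
    summable_of_sum_le (fun _ => sq_nonneg _) hB
  refine (tsum_of_norm_bounded (hsum.mul_left δ).hasSum fun w => ?_).trans ?_
  · rw [norm_mul, norm_mul, norm_mul, norm_star]
    split_ifs with hw
    · have hmul := mul_le_mul_of_nonneg_right (hθ w hw) (sq_nonneg ‖s i j (γ, w)‖)
      rw [norm_one]
      linarith
    · simp only [norm_zero, mul_zero, zero_mul]
      positivity
  · rw [tsum_mul_left]
    exact mul_le_mul_of_nonneg_left (hsum.tsum_le_of_sum_le hB) hδ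

end FiberSum

variable {G ι : Type u} [Group G] {g : ι → G} {C : ℝ}

theorem IsSidonWith.exists_isPosDefFun_approx_indicator (hS : IsSidonWith C g)
    (hg : Function.Injective g) (hC : 0 ≤ C) {r : ℝ} (h0 : 0 ≤ r) (h1 : r ≤ 1) :
    ∃ h : Fin 2 → Fin 2 → G → ℂ, IsPosDefFun h ∧ (∀ i, h i i 1 = C ^ 2) ∧
      (∀ t, h 0 1 (g t) = r) ∧ ∀ γ, γ ∉ Set.range g → ‖h 0 1 γ‖ ≤ r ^ 2 * C ^ 2 := by
  obtain ⟨s, hs, hs1, hs0, hst, hst0⟩ := hS.exists_isPosDefFun hg hC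
  obtain ⟨θ, hθ, hθ1, hθt, hθ0⟩ :=
    exists_isPosDefFun_approx_indicator_generators (α := ι) h0 h1
  let φ : FreeGroup ι →* G := FreeGroup.lift g
  have hφ (t : ι) : φ (FreeGroup.of t) = g t := FreeGroup.lift_apply_of
  refine ⟨fiberSum φ θ s, hs.fiberSum φ hθ hs0, fun i => ?_, fun t => ?_, fun γ hγ => ?_⟩
  · have hsi : s i i (1, 1) = C := hs1 i
    rw [fiberSum_eq_of_forall_ne φ (map_one φ) (hs0 i), hθ1, hsi, Complex.norm_real,
      Real.norm_of_nonneg hC, one_mul]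
  · rw [fiberSum_eq_of_forall_ne φ (hφ t) (hst0 t), hθt, hst, norm_one, Complex.ofReal_one,
      one_pow, mul_one]
  · refine norm_fiberSum_le φ (sq_nonneg r) (fun w hw => hθ0 w ?_) fun T => ?_
    · rintro ⟨t, rfl⟩
      exact hγ ⟨t, (hφ t).symm.trans hw⟩
    · rw [sq C]
      refine hs.sum_norm_sq_le (hs1 0) (hs1 1) (fun w w' hne => ?_) T
      simpa using hs0 1 (w⁻¹ * w') (inv_mul_eq_one.not.mpr hne)

/-- The error of `h` on the complement of `g` is quadratic in its value `r` on `g`: dividing by a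
small `r` makes the error small at the cost of the multiplier norm. -/
theorem IsSidonWith.exists_multiplier (hS : IsSidonWith C g) (hg : Function.Injective g)
    (hC : 0 < C) {ε : ℝ} (hε : 0 < ε) :
    ∃ (f : G → ℂ) (D : ℝ), (∀ t, f (g t) = 1) ∧ (∀ γ, γ ∉ Set.range g → ‖f γ‖ ≤ ε) ∧
      ∀ {κ : Type u} (m : ℕ) (s : Finset κ) (a : κ → Matrix (Fin m) (Fin m) ℂ) (k : κ → G),
        universalNorm s (fun i => f (k i) • a i) k ≤ D * universalNorm s a k := by
  let r : ℝ := min 1 (ε / C ^ 2)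
  have hr0 : 0 < r := lt_min one_pos (by positivity)
  have hr : r * C ^ 2 ≤ ε := (le_div_iff₀ (by positivity)).mp (min_le_right _ _)
  have hr_norm : ‖(r : ℂ)⁻¹‖ = r⁻¹ := by
    rw [norm_inv, Complex.norm_real, Real.norm_of_nonneg hr0.le]
  obtain ⟨h, hh, h1, ht, hoff⟩ :=
    hS.exists_isPosDefFun_approx_indicator hg hC.le hr0.le (min_le_left _ _)
  refine ⟨fun γ => (r : ℂ)⁻¹ * h 0 1 γ, r⁻¹ * C ^ 2, fun t => ?_, fun γ hγ => ?_,
    fun m s a k => ?_⟩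
  · simp only [ht]
    exact inv_mul_cancel₀ (by exact_mod_cast hr0.ne')
  · calc ‖(r : ℂ)⁻¹ * h 0 1 γ‖ ≤ r⁻¹ * (r ^ 2 * C ^ 2) := by
          rw [norm_mul, hr_norm]
          gcongr
          exact hoff γ hγ
      _ = r * C ^ 2 := by field_simp
      _ ≤ ε := hr
  · simp only [mul_smul]
    rw [universalNorm_smul, hr_norm, mul_assoc]
    gcongr
    exact hh.universalNorm_mul_le (by exact_mod_cast (h1 0).le) (by exact_mod_cast (h1 1).le) s a k

end Interpolation

section Union

theorem universalNorm_preimage {G ι κ : Type*} [Group G] {e : κ → ι} (he : Function.Injective e)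
    {m : ℕ} (s : Finset ι) (a : ι → Matrix (Fin m) (Fin m) ℂ) (g : ι → G)
    (ha : ∀ i, i ∉ Set.range e → a i = 0) :
    universalNorm (s.preimage e he.injOn) (a ∘ e) (g ∘ e) = universalNorm s a g := by
  unfold universalNorm
  congr 1
  ext p q
  exact Finset.sum_preimage e s he.injOn
    (fun i => a i p q • (GroupCStar.universalRep (g i) : GroupCStar G)) fun i _ hi => by
      simp [ha i hi]

variable {G ι : Type u} [Group G] {g : ι → G}

theorem IsSidonWith.universalNorm_le_of_comp {κ : Type u} {e : κ → ι} {C : ℝ}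
    (hS : IsSidonWith C (g ∘ e)) (he : Function.Injective e) {m : ℕ} (s : Finset ι)
    (a : ι → Matrix (Fin m) (Fin m) ℂ) (ha : ∀ i, i ∉ Set.range e → a i = 0) :
    universalNorm s a FreeGroup.of ≤ C * universalNorm s a g := by
  rw [← universalNorm_preimage he s a _ ha, ← universalNorm_preimage he s a _ ha]
  refine le_trans ?_ (hS m _ _)
  simpa only [one_smul] using universalNorm_unimodular_smul_le (s.preimage e he.injOn) (a ∘ e)
    (FreeGroup.of ∘ e) (z := fun _ => 1) fun _ => norm_one

theorem IsSidonWith.exists_universalNorm_indicator_smul_le {κ : Type u} {e : κ → ι} {C : ℝ}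
    (hS : IsSidonWith C (g ∘ e)) (he : Function.Injective e) (hg : Function.Injective g)
    (hC : 0 < C) {ε : ℝ} (hε : 0 < ε) :
    ∃ D : ℝ, ∀ (m : ℕ) (s : Finset ι) (a : ι → Matrix (Fin m) (Fin m) ℂ),
      universalNorm s (fun i => (Set.range e).indicator (1 : ι → ℂ) i • a i) g ≤
        D * universalNorm s a g + ε * universalNorm s a FreeGroup.of := by
  obtain ⟨f, D, hf_one, hf_small, hf⟩ := hS.exists_multiplier (hg.comp he) hC hε
  refine ⟨D, fun m s a => ?_⟩
  let z : ι → ℂ := (Set.range e).indicator 1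
  have hz (i : ι) : ‖z i - f (g i)‖ ≤ ε := by
    by_cases hi : i ∈ Set.range e
    · obtain ⟨t, rfl⟩ := hi
      have hft : f (g (e t)) = 1 := hf_one t
      simpa [z, hft] using hε.le
    · have hgi : g i ∉ Set.range (g ∘ e) := fun ⟨t, ht⟩ => hi ⟨t, hg ht⟩
      simpa [z, hi] using hf_small _ hgi
  calc universalNorm s (fun i => z i • a i) g
      = universalNorm s (fun i => f (g i) • a i + (z i - f (g i)) • a i) g := by
        simp only [← add_smul, add_sub_cancel]
    _ ≤ D * universalNorm s a g + ε * universalNorm s a FreeGroup.of :=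
        (universalNorm_add_le ..).trans
          (add_le_add (hf m s a g) (universalNorm_smul_le_of_norm_le s a g hε hz))

/-- With `ε` this small, the error term of the indicator of the first family is at most half of the
norm to be estimated, and is absorbed into the left-hand side. -/
theorem exists_isSidonWith_of_cover {κ₁ κ₂ : Type u} {e₁ : κ₁ → ι} {e₂ : κ₂ → ι}
    (he₁ : Function.Injective e₁) (he₂ : Function.Injective e₂)
    (hcover : ∀ i, i ∈ Set.range e₁ ∨ i ∈ Set.range e₂) (hg : Function.Injective g) {C₁ C₂ : ℝ}
    (hC₁ : 0 < C₁) (hC₂ : 0 < C₂) (h₁ : IsSidonWith C₁ (g ∘ e₁)) (h₂ : IsSidonWith C₂ (g ∘ e₂)) :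
    ∃ C, IsSidonWith C g := by
  let ε : ℝ := (2 * (C₁ + C₂))⁻¹
  obtain ⟨D, hD⟩ := h₁.exists_universalNorm_indicator_smul_le he₁ hg hC₁
    (show 0 < ε by positivity)
  refine ⟨2 * (C₂ + (C₁ + C₂) * D), fun m s a => ?_⟩
  let b (i : ι) : Matrix (Fin m) (Fin m) ℂ := (Set.range e₁).indicator (1 : ι → ℂ) i • a i
  have hG : universalNorm s b g ≤ D * universalNorm s a g + ε * universalNorm s a FreeGroup.of :=
    hD m s a
  have hfree : universalNorm s a FreeGroup.of ≤
      C₁ * universalNorm s b g + C₂ * universalNorm s (fun i => a i - b i) g := by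
    calc universalNorm s a FreeGroup.of
        = universalNorm s (fun i => b i + (a i - b i)) FreeGroup.of := by
          simp only [add_sub_cancel]
      _ ≤ universalNorm s b FreeGroup.of +
            universalNorm s (fun i => a i - b i) FreeGroup.of := universalNorm_add_le ..
      _ ≤ C₁ * universalNorm s b g + C₂ * universalNorm s (fun i => a i - b i) g := by
          gcongr
          · exact h₁.universalNorm_le_of_comp he₁ s b fun i hi => by simp [b, hi]
          · exact h₂.universalNorm_le_of_comp he₂ s _ fun i hi => by
              simp [b, (hcover i).resolve_right hi]
  have habsorb : (C₁ + C₂) * (ε * universalNorm s a FreeGroup.of) =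
      universalNorm s a FreeGroup.of / 2 := by
    simp only [ε]
    field_simp
  linarith [mul_le_mul_of_nonneg_left (universalNorm_sub_le s a b g) hC₂.le,
    mul_le_mul_of_nonneg_left hG (add_pos hC₁ hC₂).le]

end Union

theorem IsCompletelySidonSet.exists_isSidonWith {G : Type u} [Group G] {Λ : Set G}
    (hΛ : IsCompletelySidonSet Λ) : ∃ C, 0 < C ∧ IsSidonWith C ((↑) : Λ → G) := by
  obtain ⟨-, C, hC⟩ := hΛ
  refine ⟨max 1 C, by positivity, fun m s a => (hC m s a).trans ?_⟩
  exact mul_le_mul_of_nonneg_right (le_max_right _ _) (universalNorm_nonneg _ _ _)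

theorem IsSidonWith.isCompletelySidonSet {G : Type u} [Group G] {Λ : Set G} {C : ℝ}
    (hS : IsSidonWith C ((↑) : Λ → G)) : IsCompletelySidonSet Λ :=
  ⟨⟨‖(1 : GroupCStar G)‖, fun i => by
    simpa using (CStarRing.norm_coe_unitary_mul (GroupCStar.universalRep (i : G)) 1).le⟩, C, hS⟩

theorem mainTheorem2 {G : Type u} [Group G] (Λ₁ Λ₂ : Set G)
    (h₁ : IsCompletelySidonSet Λ₁) (h₂ : IsCompletelySidonSet Λ₂) :
    IsCompletelySidonSet (Λ₁ ∪ Λ₂) := by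
  obtain ⟨C₁, hC₁, hS₁⟩ := h₁.exists_isSidonWith
  obtain ⟨C₂, hC₂, hS₂⟩ := h₂.exists_isSidonWith
  have hcover (i : ↥(Λ₁ ∪ Λ₂)) : i ∈ Set.range (Set.inclusion Set.subset_union_left) ∨
      i ∈ Set.range (Set.inclusion Set.subset_union_right) :=
    i.2.imp (fun hi => ⟨⟨i, hi⟩, rfl⟩) fun hi => ⟨⟨i, hi⟩, rfl⟩
  obtain ⟨C, hS⟩ := exists_isSidonWith_of_cover (Set.inclusion_injective _)
    (Set.inclusion_injective _) hcover Subtype.val_injective hC₁ hC₂ hS₁ hS₂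
  exact hS.isCompletelySidonSet
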